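/- Let $\mathbf{SU}(2)$ be the group of $2\times 2$ complex unitary matrices of determinant $1$, with normalized Haar measure $\mu$, and let $$X=\begin{pmatrix}0&1\\-1&0\end{pmatrix},\qquad Y=\begin{pmatrix}0&i\\ i&0\end{pmatrix},\qquad Z=\begin{pmatrix}i&0\\0&-i\end{pmatrix}.$$ Denote also by $X,Y$ the corresponding left-invariant vector fields, $(Xf)(g)=\frac{d}{ds}\big|_{s=0}f(g\,e^{sX})$ and likewise for $Y$, and let $\mathcal L=X^2+Y^2$. There is exactly one strongly continuous semigroup $(P_t)_{t\ge 0}$ of bounded operators on $C(\mathbf{SU}(2),\mathbb R)$ whose infinitesimal generator extends $\mathcal L$ on smooth functions; it is the heat semigroup $P_t=e^{t\mathcal L}$. For every $t>0$ there is a continuous function $p_t$ on $\mathbf{SU}(2)$ with $$(P_tf)(1)=\int_{\mathbf{SU}(2)}p_t\,f\,d\mu\qquad\text{for all } f\in C(\mathbf{SU}(2),\mathbb R)$$ (the subelliptic heat kernel issued from the identity). Use the cylindric coordinates $$(r,\theta,z)\mapsto \exp(r\cos\theta\, X+r\sin\theta\, Y)\exp(zZ).$$ Then, for any such $p_t$ and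 all $t>0$, $0\le r<\frac{\pi}{2}$, $\theta\in[0,2\pi]$, $z\in[-\pi,\pi]$, the value of $p_t$ at the point with coordinates $(r,\theta,z)$ does not depend on $\theta$ and, denoted by $p_t(r,z)$, equals $$p_t(r,z)=\sum_{n\in\mathbb Z}\sum_{k=0}^{\infty}(2k+|n|+1)\,e^{-(4k(k+|n|+1)+2|n|)t}\,e^{inz}(\cos r)^{|n|}P_k^{0,|n|}(\cos 2r),$$ where the double series converges absolutely and $$P_k^{0,|n|}(x)=\frac{(-1)^k}{2^k\,k!\,(1+x)^{|n|}}\frac{d^k}{dx^k}\Big((1+x)^{|n|}(1-x^2)^k\Big)$$ is a Jacobi polynomial. -/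

import Mathlib

open scoped NNReal Topology ContDiff

/-- The group `SU(2)` of `2 × 2` complex unitary matrices of determinant one. -/
abbrev SU2 : Type := Matrix.specialUnitaryGroup (Fin 2) ℂ

instance SU2.instContinuousInv : ContinuousInv SU2 where
  continuous_inv := by
    refine Continuous.subtype_mk (f := fun x : SU2 => star (x : Matrix (Fin 2) (Fin 2) ℂ)) ?_ _
    exact continuous_star.comp continuous_subtype_val

instance SU2.instIsTopologicalGroup : IsTopologicalGroup SU2 where

instance SU2.instCompactSpace : CompactSpace SU2 := by
  refine isCompact_iff_compactSpace.mp (?_ : IsCompact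
    (Matrix.specialUnitaryGroup (Fin 2) ℂ : Set (Matrix (Fin 2) (Fin 2) ℂ)))
  have hK : IsCompact (Set.pi Set.univ (fun _ : Fin 2 => Set.pi Set.univ
      (fun _ : Fin 2 => Metric.closedBall (0 : ℂ) 1))) :=
    isCompact_univ_pi fun _ => isCompact_univ_pi fun _ => isCompact_closedBall 0 1
  refine IsCompact.of_isClosed_subset hK ?_ ?_
  · have h : (Matrix.specialUnitaryGroup (Fin 2) ℂ : Set (Matrix (Fin 2) (Fin 2) ℂ)) =
        {A | star A * A = 1} ∩ ({A | A * star A = 1} ∩ {A | A.det = 1}) := by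
      ext A
      simp [Matrix.mem_specialUnitaryGroup_iff, Matrix.unitaryGroup, Unitary.mem_iff, and_assoc]
    rw [h]
    refine (isClosed_eq (by fun_prop) continuous_const).inter
      ((isClosed_eq (by fun_prop) continuous_const).inter
        (isClosed_eq (by fun_prop) continuous_const))
  · intro A hA i _ j _
    simpa using entry_norm_bound_of_unitary
      (Matrix.specialUnitaryGroup_le_unitaryGroup hA) i j

noncomputable instance SU2.instMeasurableSpace : MeasurableSpace SU2 := borel SU2

instance SU2.instBorelSpace : BorelSpace SU2 := ⟨rfl⟩

/-- The normalized (total mass one) bi-invariant Haar measure of `SU(2)`. -/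
noncomputable def SU2.haar : MeasureTheory.Measure SU2 := MeasureTheory.Measure.haarMeasure ⊤

/-- The matrix `a X + b Y + c Z` of the Lie algebra `su(2)`, where
`X = !![0, 1; -1, 0]`, `Y = !![0, i; i, 0]` and `Z = !![i, 0; 0, -i]`. -/
noncomputable def su2Mat (a b c : ℝ) : Matrix (Fin 2) (Fin 2) ℂ :=
  (a : ℂ) • !![0, 1; -1, 0] + (b : ℂ) • !![0, Complex.I; Complex.I, 0]
    + (c : ℂ) • !![Complex.I, 0; 0, -Complex.I]

theorem exp_su2Mat_mem (a b c : ℝ) :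
    NormedSpace.exp (su2Mat a b c) ∈ Matrix.specialUnitaryGroup (Fin 2) ℂ := by
  have hstar : star (su2Mat a b c) = -su2Mat a b c := by
    ext i j
    fin_cases i <;> fin_cases j <;> simp [su2Mat, Matrix.star_apply] <;> ring
  have hmul : NormedSpace.exp (su2Mat a b c) * NormedSpace.exp (-su2Mat a b c) = 1 := by
    rw [← Matrix.exp_add_of_commute _ _ (Commute.neg_right (Commute.refl (su2Mat a b c))), add_neg_cancel,
      NormedSpace.exp_zero]
  have hmul' : NormedSpace.exp (-su2Mat a b c) * NormedSpace.exp (su2Mat a b c) = 1 := by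
    rw [← Matrix.exp_add_of_commute _ _ (Commute.neg_left (Commute.refl (su2Mat a b c))), neg_add_cancel,
      NormedSpace.exp_zero]
  have hse : star (NormedSpace.exp (su2Mat a b c)) = NormedSpace.exp (-su2Mat a b c) := by
    rw [Matrix.star_eq_conjTranspose, ← Matrix.exp_conjTranspose, ← Matrix.star_eq_conjTranspose,
      hstar]
  rw [Matrix.mem_specialUnitaryGroup_iff]
  refine ⟨?_, ?_⟩
  · rw [Matrix.unitaryGroup, Unitary.mem_iff, hse]
    exact ⟨hmul', hmul⟩
  · set J : Matrix (Fin 2) (Fin 2) ℂ := !![0, 1; -1, 0] with hJ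
    have hJdet : IsUnit J := by
      rw [Matrix.isUnit_iff_isUnit_det, hJ]
      simp
    have hJJ : J * J = -1 := by
      ext i j
      fin_cases i <;> fin_cases j <;> simp [hJ, Matrix.mul_apply, Fin.sum_univ_two]
    have hinv : J⁻¹ = -J := by
      apply Matrix.inv_eq_right_inv
      rw [mul_neg, hJJ, neg_neg]
    have hadj : ∀ A : Matrix (Fin 2) (Fin 2) ℂ, A.adjugate = J * A.transpose * J⁻¹ := by
      intro A
      rw [hinv, Matrix.adjugate_fin_two]
      ext i j
      fin_cases i <;> fin_cases j <;>
        simp [hJ, Matrix.mul_apply, Matrix.vecMul, dotProduct, Fin.sum_univ_two]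
    have h1 : (su2Mat a b c).adjugate = -su2Mat a b c := by
      rw [Matrix.adjugate_fin_two]
      ext i j
      fin_cases i <;> fin_cases j <;> simp [su2Mat]
    have h2 : (NormedSpace.exp (su2Mat a b c)).adjugate = NormedSpace.exp (-su2Mat a b c) := by
      rw [hadj, ← Matrix.exp_transpose, ← Matrix.exp_conj _ _ hJdet, ← hadj, h1]
    have h3 := Matrix.mul_adjugate (NormedSpace.exp (su2Mat a b c))
    rw [h2, hmul] at h3
    have h4 := congrFun (congrFun h3 0) 0
    simpa using h4.symm

/-- The group element `exp (a X + b Y + c Z)` of `SU(2)`. -/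
noncomputable def SU2.exp (a b c : ℝ) : SU2 :=
  ⟨NormedSpace.exp (su2Mat a b c), exp_su2Mat_mem a b c⟩

/-- The point of `SU(2)` with cylindric coordinates `(r, θ, z)`. -/
noncomputable def SU2.cyl (r θ z : ℝ) : SU2 :=
  SU2.exp (r * Real.cos θ) (r * Real.sin θ) 0 * SU2.exp 0 0 z

/-- Smooth functions on `SU(2)`: restrictions of smooth functions of the four complex matrix
entries, `SU(2)` being a closed embedded submanifold of the space of matrices. -/
def SU2.IsSmooth (f : SU2 → ℝ) : Prop :=
  ∃ F : (Fin 2 → Fin 2 → ℂ) → ℝ, ContDiff ℝ ∞ F ∧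
    ∀ g : SU2, f g = F (fun i j => (g : Matrix (Fin 2) (Fin 2) ℂ) i j)

/-- The left invariant vector field `a X + b Y + c Z` acting on functions:
the derivative at `s = 0` of `f (g exp (s (a X + b Y + c Z)))`. -/
noncomputable def SU2.vectorField (a b c : ℝ) (f : SU2 → ℝ) (g : SU2) : ℝ :=
  deriv (fun s : ℝ => f (g * SU2.exp (s * a) (s * b) (s * c))) 0

/-- The sublaplacian `L = X² + Y²`. -/
noncomputable def SU2.sublaplacian (f : SU2 → ℝ) (g : SU2) : ℝ :=
  SU2.vectorField 1 0 0 (SU2.vectorField 1 0 0 f) g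
    + SU2.vectorField 0 1 0 (SU2.vectorField 0 1 0 f) g

/-- `P` is the heat semigroup `P_t = e^{tL}` on the Banach space of continuous functions on
`SU(2)`: the strongly continuous semigroup of bounded operators whose infinitesimal generator
extends the sublaplacian `L` on smooth functions. (As smooth functions are a core,
the generator is then the closure of `L`, and there is only one such semigroup.) -/
structure SU2.IsHeatSemigroup (P : ℝ≥0 → (C(SU2, ℝ) →L[ℝ] C(SU2, ℝ))) : Prop where
  zero : P 0 = ContinuousLinearMap.id ℝ C(SU2, ℝ)
  add : ∀ s t : ℝ≥0, P (s + t) = (P s).comp (P t)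
  strongly_continuous : ∀ f : C(SU2, ℝ), Continuous fun t : ℝ≥0 => P t f
  generator : ∀ f : C(SU2, ℝ), SU2.IsSmooth f →
    TendstoUniformly (fun (t : ℝ≥0) (g : SU2) => (P t f g - f g) / (t : ℝ))
      (SU2.sublaplacian f) (𝓝[>] 0)

/-- `p t` is, for each `t > 0`, the continuous density of `f ↦ (P_t f)(1)` with respect to the
normalized Haar measure: `p` is the kernel issued from the identity of the semigroup `P`. -/
def SU2.IsKernelFromOne (P : ℝ≥0 → (C(SU2, ℝ) →L[ℝ] C(SU2, ℝ))) (p : ℝ≥0 → SU2 → ℝ) : Prop :=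
  ∀ t : ℝ≥0, 0 < t → Continuous (p t) ∧
    ∀ f : C(SU2, ℝ), P t f 1 = ∫ g, p t g * f g ∂SU2.haar

/-- The Jacobi polynomial `P_k^{0,m}`, by Rodrigues' formula (used for `x ≠ -1`). -/
noncomputable def jacobiP (k m : ℕ) (x : ℝ) : ℝ :=
  (-1) ^ k / (2 ^ k * (k.factorial : ℝ) * (1 + x) ^ m) *
    iteratedDeriv k (fun y : ℝ => (1 + y) ^ m * (1 - y ^ 2) ^ k) x

/-! In the entries `α`, `β` of a matrix, SU(2) is the sphere |α|² + |β|² = 1. Polynomials in `α`,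
`β` and their conjugates are uniformly dense (Stone–Weierstrass) and stable under the sublaplacian
L. Each of them is a finite sum of polynomial eigenfunctions of L, because L is triangular with
distinct diagonal entries along suitable chains of monomials (`exists_eigenfunction_decomposition`).
A heat semigroup must multiply an eigenfunction of eigenvalue μ by e^{μt}, so density gives
uniqueness.

For existence the kernel is written down as a series. Each irreducible representation of dimension
2k + |n| + 1 contributes the zonal function `zonal (n, k)`, a normalized diagonal matrix
coefficient. It is an eigenfunction of L with the eigenvalue in the exponent (`hasLap_phi`) and is
bounded by 1 (`norm_phi_le_one`), so the series weighted by dimension and exponential converges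
absolutely and uniformly for t > 0. At time 0 the same series is a Dirac mass at the identity on
polynomials: F(1) = ∑ dim · ∫ zonal · F (`zonalInversion_of_mem`). This is proved by computing the
integrals explicitly and telescoping, without the Peter–Weyl theorem. Since L is symmetric, an
eigenfunction pairs only with zonal functions of its own eigenvalue, hence integrating it against
the kernel gives e^{μt} times its value at 1 (`integral_kernel_eigenfunction`).

Convolution with the kernel therefore has the right action on polynomials. The parabolic maximum
principle makes it a contraction (`norm_heat_le`), and the semigroup law and strong continuity
extend by density; the generator comes from differentiating the series and the mean value theorem.

A continuous density is unique, so every kernel is this series. Zonal functions depend on `α` alone,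
which in cylindric coordinates is cos r · e^{iz}; expanding Rodrigues' formula by Leibniz identifies
them with e^{inz} (cos r)^{|n|} times a Jacobi polynomial in cos 2r. -/

open ComplexConjugate

namespace SU2

/-! ### Coordinates on the group and one-parameter subgroups -/

/-- The upper left entry of a matrix in `SU(2)`. -/
def α (g : SU2) : ℂ := (g : Matrix (Fin 2) (Fin 2) ℂ) 0 0

/-- The upper right entry of a matrix in `SU(2)`. -/
def β (g : SU2) : ℂ := (g : Matrix (Fin 2) (Fin 2) ℂ) 0 1

theorem adjugate_eq_star (g : SU2) :
    (g : Matrix (Fin 2) (Fin 2) ℂ).adjugate = star (g : Matrix (Fin 2) (Fin 2) ℂ) := by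
  obtain ⟨hu, hd⟩ := Matrix.mem_specialUnitaryGroup_iff.mp g.2
  have h1 : star (g : Matrix (Fin 2) (Fin 2) ℂ) * g = 1 := (Unitary.mem_iff.mp hu).1
  calc (g : Matrix (Fin 2) (Fin 2) ℂ).adjugate
      = star (g : Matrix (Fin 2) (Fin 2) ℂ) * g * (g : Matrix (Fin 2) (Fin 2) ℂ).adjugate := by
        rw [h1, one_mul]
    _ = _ := by rw [mul_assoc, Matrix.mul_adjugate, hd, one_smul, mul_one]

theorem apply_one_one (g : SU2) : (g : Matrix (Fin 2) (Fin 2) ℂ) 1 1 = conj (α g) := by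
  have := congrFun (congrFun (adjugate_eq_star g) 0) 0
  simpa [Matrix.adjugate_fin_two, Matrix.star_apply, α] using this

theorem apply_one_zero (g : SU2) : (g : Matrix (Fin 2) (Fin 2) ℂ) 1 0 = -conj (β g) := by
  have := congrFun (congrFun (adjugate_eq_star g) 1) 0
  have h : -(g : Matrix (Fin 2) (Fin 2) ℂ) 1 0 = conj (β g) := by
    simpa [Matrix.adjugate_fin_two, Matrix.star_apply, β] using this
  rw [← h, neg_neg]

theorem α_mul (g h : SU2) : α (g * h) = α g * α h - β g * conj (β h) := by
  have : α (g * h) = α g * α h + β g * (h : Matrix (Fin 2) (Fin 2) ℂ) 1 0 := by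
    simp [α, β, Matrix.mul_apply, Fin.sum_univ_two]
  rw [this, apply_one_zero]; ring

theorem β_mul (g h : SU2) : β (g * h) = α g * β h + β g * conj (α h) := by
  have : β (g * h) = α g * β h + β g * (h : Matrix (Fin 2) (Fin 2) ℂ) 1 1 := by
    simp [α, β, Matrix.mul_apply, Fin.sum_univ_two]
  rw [this, apply_one_one]

theorem α_one : α (1 : SU2) = 1 := by simp [α]

theorem β_one : β (1 : SU2) = 0 := by simp [β]

theorem α_mul_conj_add (g : SU2) : α g * conj (α g) + β g * conj (β g) = 1 := by
  have hd := (Matrix.mem_specialUnitaryGroup_iff.mp g.2).2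
  rw [Matrix.det_fin_two, apply_one_one, apply_one_zero] at hd
  rw [← hd]; simp only [α, β]; ring

theorem continuous_α : Continuous α := by
  exact (continuous_apply_apply (0 : Fin 2) (0 : Fin 2)).comp continuous_subtype_val

theorem continuous_β : Continuous β := by
  exact (continuous_apply_apply (0 : Fin 2) (1 : Fin 2)).comp continuous_subtype_val

theorem ext_αβ {g h : SU2} (h1 : α g = α h) (h2 : β g = β h) : g = h := by
  apply Subtype.ext
  ext i j
  fin_cases i <;> fin_cases j
  · exact h1
  · exact h2
  · exact (apply_one_zero g).trans (h2 ▸ (apply_one_zero h).symm)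
  · exact (apply_one_one g).trans (h1 ▸ (apply_one_one h).symm)

/-- Diagonalization: with w = x + iy of modulus 1, the vectors (w, i) and (w, -i), which are the
columns of `W`, are eigenvectors with eigenvalues is and -is. -/
theorem exp_horizontal (x y s : ℝ) (h : x ^ 2 + y ^ 2 = 1) :
    NormedSpace.exp (su2Mat (s * x) (s * y) 0) =
      !![(Real.cos s : ℂ), (x + Complex.I * y) * (Real.sin s : ℂ);
        (-x + Complex.I * y) * (Real.sin s : ℂ), (Real.cos s : ℂ)] := by
  set w : ℂ := x + Complex.I * y with hw
  have hw' : w * (x - Complex.I * y) = 1 := by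
    have : (x : ℂ) ^ 2 + (y : ℂ) ^ 2 = 1 := by exact_mod_cast h
    linear_combination this - (y : ℂ) ^ 2 * Complex.I_sq
  have hc : (x : ℂ) ^ 2 + (y : ℂ) ^ 2 = 1 := by exact_mod_cast h
  have hw'' : (-x + Complex.I * y) * w = -1 := by linear_combination -hw'
  have hw0 : w ≠ 0 := left_ne_zero_of_mul_eq_one hw'
  have hI := Complex.I_mul_I
  set W : Matrix (Fin 2) (Fin 2) ℂ := !![w, w; Complex.I, -Complex.I] with hW
  have hdet : W.det ≠ 0 := by
    rw [Matrix.det_fin_two_of]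
    intro h0
    have : w * (2 * Complex.I) = 0 := by linear_combination -h0
    simp [hw0] at this
  have hWu : IsUnit W := (Matrix.isUnit_iff_isUnit_det _).mpr (isUnit_iff_ne_zero.mpr hdet)
  have hWd : IsUnit W.det := isUnit_iff_ne_zero.mpr hdet
  set d : Fin 2 → ℂ := ![Complex.I * s, -(Complex.I * s)] with hd
  have key : su2Mat (s * x) (s * y) 0 = W * Matrix.diagonal d * W⁻¹ := by
    have : su2Mat (s * x) (s * y) 0 * W = W * Matrix.diagonal d := by
      ext i j
      fin_cases i <;> fin_cases j <;>
        simp [su2Mat, hW, hd, Matrix.mul_apply, Fin.sum_univ_two, hw] <;> ring_nf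
      · linear_combination (-(s : ℂ)) * hc + (s : ℂ) * ((y : ℂ) ^ 2 - 1) * Complex.I_sq
      · linear_combination (-(s : ℂ)) * hc + (s : ℂ) * ((y : ℂ) ^ 2 - 1) * Complex.I_sq
    rw [← this, mul_assoc, Matrix.mul_nonsing_inv _ hWd, mul_one]
  rw [key, Matrix.exp_conj _ _ hWu, Matrix.exp_diagonal]
  have : ∀ M : Matrix (Fin 2) (Fin 2) ℂ, W * Matrix.diagonal (NormedSpace.exp d) = M * W →
      W * Matrix.diagonal (NormedSpace.exp d) * W⁻¹ = M := by
    intro M hM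
    rw [hM, mul_assoc, Matrix.mul_nonsing_inv _ hWd, mul_one]
  apply this
  have e0 : NormedSpace.exp d 0 = Real.cos s + Real.sin s * Complex.I := by
    rw [Pi.coe_exp, ← Complex.exp_eq_exp_ℂ]
    simp [hd, mul_comm Complex.I, Complex.exp_mul_I]
  have e1 : NormedSpace.exp d 1 = Real.cos s - Real.sin s * Complex.I := by
    rw [Pi.coe_exp, ← Complex.exp_eq_exp_ℂ]
    simp [hd, mul_comm Complex.I, ← neg_mul, Complex.exp_mul_I]
    ring
  ext i j
  fin_cases i <;> fin_cases j <;>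
    simp [hW, Matrix.mul_apply, Fin.sum_univ_two, e0, e1]
  · ring
  · ring
  · linear_combination Complex.sin s * hI - Complex.sin s * hw''
  · linear_combination Complex.sin s * hI - Complex.sin s * hw''

theorem exp_vertical (z : ℝ) : NormedSpace.exp (su2Mat 0 0 z) =
    !![Complex.exp (Complex.I * z), 0; 0, Complex.exp (-(Complex.I * z))] := by
  have : su2Mat 0 0 z = Matrix.diagonal ![Complex.I * z, -(Complex.I * z)] := by
    ext i j
    fin_cases i <;> fin_cases j <;> simp [su2Mat, mul_comm]
  rw [this, Matrix.exp_diagonal]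
  ext i j
  fin_cases i <;> fin_cases j <;> simp [Pi.coe_exp, ← Complex.exp_eq_exp_ℂ]

theorem α_exp_horizontal {x y : ℝ} (h : x ^ 2 + y ^ 2 = 1) (s : ℝ) :
    α (SU2.exp (s * x) (s * y) 0) = Real.cos s := by
  simp [α, SU2.exp, exp_horizontal x y s h]

theorem β_exp_horizontal {x y : ℝ} (h : x ^ 2 + y ^ 2 = 1) (s : ℝ) :
    β (SU2.exp (s * x) (s * y) 0) = (x + Complex.I * y) * Real.sin s := by
  simp [β, SU2.exp, exp_horizontal x y s h]

theorem α_exp_vertical (z : ℝ) : α (SU2.exp 0 0 z) = Complex.exp (Complex.I * z) := by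
  simp [α, SU2.exp, exp_vertical]

theorem β_exp_vertical (z : ℝ) : β (SU2.exp 0 0 z) = 0 := by
  simp [β, SU2.exp, exp_vertical]

/-- The angle θ enters only through `β`; this is why functions of `α` alone, such as the zonal
functions, do not see it. -/
theorem α_cyl (r θ z : ℝ) :
    α (SU2.cyl r θ z) = Real.cos r * Complex.exp (Complex.I * z) := by
  rw [cyl, α_mul, α_exp_horizontal (by simp), α_exp_vertical, β_exp_vertical]
  simp

theorem exp_horizontal_zero (x y : ℝ) : SU2.exp (0 * x) (0 * y) 0 = 1 := by
  apply Subtype.ext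
  have : su2Mat 0 0 0 = 0 := by
    ext i j
    fin_cases i <;> fin_cases j <;> simp [su2Mat]
  simp [SU2.exp, this]

theorem exp_horizontal_add {x y : ℝ} (h : x ^ 2 + y ^ 2 = 1) (s t : ℝ) :
    SU2.exp ((s + t) * x) ((s + t) * y) 0 =
      SU2.exp (s * x) (s * y) 0 * SU2.exp (t * x) (t * y) 0 := by
  have h' : ((x : ℂ) + Complex.I * y) * (x - Complex.I * y) = 1 := by
    have : (x : ℂ) ^ 2 + (y : ℂ) ^ 2 = 1 := by exact_mod_cast h
    linear_combination this - (y : ℂ) ^ 2 * Complex.I_sq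
  apply ext_αβ
  · rw [α_mul, α_exp_horizontal h, α_exp_horizontal h, α_exp_horizontal h, β_exp_horizontal h,
      β_exp_horizontal h]
    simp only [Real.cos_add, map_mul, map_add, Complex.conj_ofReal, Complex.conj_I]
    push_cast
    linear_combination (Complex.sin s) * (Complex.sin t) * h'
  · rw [β_mul, α_exp_horizontal h, α_exp_horizontal h, β_exp_horizontal h, β_exp_horizontal h,
      β_exp_horizontal h]
    simp only [Real.sin_add, Complex.conj_ofReal]
    push_cast
    ring

/-! ### Differential calculus along horizontal vector fields -/

/-- The horizontal one-parameter subgroup `s ↦ exp (s (x X + y Y))`. -/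
noncomputable def flow (x y s : ℝ) : SU2 := SU2.exp (s * x) (s * y) 0

theorem vectorField_eq (x y : ℝ) (f : SU2 → ℝ) (g : SU2) :
    vectorField x y 0 f g = deriv (fun s => f (g * flow x y s)) 0 := by
  simp [vectorField, flow]

/-- The matrix of a group element as an element of the space on which smooth functions live. -/
def entries (g : SU2) : Fin 2 → Fin 2 → ℂ := fun i j => (g : Matrix (Fin 2) (Fin 2) ℂ) i j

theorem continuous_entries : Continuous entries := by
  refine continuous_pi fun i => continuous_pi fun j => ?_
  exact (continuous_apply_apply i j).comp continuous_subtype_val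

/-- Right multiplication by the matrix `x X + y Y`. -/
noncomputable def rightMul (x y : ℝ) (M : Fin 2 → Fin 2 → ℂ) : Fin 2 → Fin 2 → ℂ :=
  fun i j => M i 0 * (!![0, x + Complex.I * y; -x + Complex.I * y, 0] : Matrix _ _ ℂ) 0 j +
    M i 1 * (!![0, x + Complex.I * y; -x + Complex.I * y, 0] : Matrix _ _ ℂ) 1 j

theorem contDiff_rightMul (x y : ℝ) : ContDiff ℝ ∞ (rightMul x y) := by
  unfold rightMul
  fun_prop

theorem entries_mul_flow {x y : ℝ} (h : x ^ 2 + y ^ 2 = 1) (g : SU2) (s : ℝ) :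
    entries (g * flow x y s) =
      Real.cos s • entries g + Real.sin s • rightMul x y (entries g) := by
  ext i j
  simp only [entries, flow, SU2.exp, Submonoid.coe_mul, exp_horizontal x y s h,
    Matrix.mul_apply, Fin.sum_univ_two, rightMul, Pi.add_apply, Pi.smul_apply, Complex.real_smul]
  fin_cases j <;> simp <;> ring

theorem flow_zero (x y : ℝ) : flow x y 0 = 1 := exp_horizontal_zero x y

theorem flow_add {x y : ℝ} (h : x ^ 2 + y ^ 2 = 1) (s t : ℝ) :
    flow x y (s + t) = flow x y s * flow x y t := exp_horizontal_add h s t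

theorem hasDerivAt_entries {x y : ℝ} (h : x ^ 2 + y ^ 2 = 1) (g : SU2) :
    HasDerivAt (fun s => entries (g * flow x y s)) (rightMul x y (entries g)) 0 := by
  simp only [entries_mul_flow h]
  have := ((Real.hasDerivAt_cos 0).smul_const (entries g)).fun_add
    ((Real.hasDerivAt_sin 0).smul_const (rightMul x y (entries g)))
  simp only [Real.sin_zero, Real.cos_zero, neg_zero, zero_smul, one_smul, zero_add] at this
  exact this

theorem hasDerivAt_of_entries {x y : ℝ} (h : x ^ 2 + y ^ 2 = 1) {F : (Fin 2 → Fin 2 → ℂ) → ℝ}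
    (hF : ContDiff ℝ ∞ F) (g : SU2) :
    HasDerivAt (fun s => F (entries (g * flow x y s)))
      (fderiv ℝ F (entries g) (rightMul x y (entries g))) 0 := by
  have h1 := (hF.differentiable (by simp) (entries (g * flow x y 0))).hasFDerivAt
  have h2 := h1.comp_hasDerivAt (0 : ℝ) (hasDerivAt_entries h g)
  rw [flow_zero, mul_one] at h2
  exact h2

/-- The flow is a one-parameter group, so the derivative at time s is the derivative at time 0
started from the translated point. -/
theorem hasDerivAt_flow {x y : ℝ} (h : x ^ 2 + y ^ 2 = 1) {E : Type*} [NormedAddCommGroup E]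
    [NormedSpace ℝ E] {f f' : SU2 → E}
    (hf : ∀ g, HasDerivAt (fun s => f (g * flow x y s)) (f' g) 0) (g : SU2) (s : ℝ) :
    HasDerivAt (fun s => f (g * flow x y s)) (f' (g * flow x y s)) s := by
  have h1 : HasDerivAt (fun t => f (g * flow x y s * flow x y t)) (f' (g * flow x y s)) (s - s) := by
    rw [sub_self]; exact hf _
  have h2 := HasDerivAt.scomp (h := fun t => t - s) s h1 ((hasDerivAt_id s).sub_const s)
  simp only [one_smul] at h2
  refine h2.congr_of_eventuallyEq (Filter.Eventually.of_forall fun t => ?_)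
  simp only [Function.comp, mul_assoc, ← flow_add h]
  congr 3; ring

namespace IsSmooth

variable {f f₁ f₂ : SU2 → ℝ}

theorem hasDerivAt_zero (hf : IsSmooth f) {x y : ℝ} (h : x ^ 2 + y ^ 2 = 1) (g : SU2) :
    HasDerivAt (fun s => f (g * flow x y s)) (vectorField x y 0 f g) 0 := by
  obtain ⟨F, hF, hfF⟩ := hf
  rw [vectorField_eq]
  refine DifferentiableAt.hasDerivAt ?_
  simp only [hfF]
  exact (hasDerivAt_of_entries h hF g).differentiableAt

theorem hasDerivAt (hf : IsSmooth f) {x y : ℝ} (h : x ^ 2 + y ^ 2 = 1) (g : SU2) (s : ℝ) :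
    HasDerivAt (fun s => f (g * flow x y s)) (vectorField x y 0 f (g * flow x y s)) s :=
  hasDerivAt_flow h (fun g => hf.hasDerivAt_zero h g) g s

theorem vectorField (hf : IsSmooth f) {x y : ℝ} (h : x ^ 2 + y ^ 2 = 1) :
    IsSmooth (vectorField x y 0 f) := by
  obtain ⟨F, hF, hfF⟩ := hf
  refine ⟨fun M => fderiv ℝ F M (rightMul x y M), ?_, fun g => ?_⟩
  · exact (hF.fderiv_right (by simp)).clm_apply (contDiff_rightMul x y)
  · rw [vectorField_eq]
    simp only [hfF]
    exact (hasDerivAt_of_entries h hF g).deriv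

theorem add (h₁ : IsSmooth f₁) (h₂ : IsSmooth f₂) : IsSmooth (f₁ + f₂) := by
  obtain ⟨F, hF, h⟩ := h₁
  obtain ⟨G, hG, h'⟩ := h₂
  exact ⟨F + G, hF.add hG, fun g => by simp [h, h']⟩

theorem mul (h₁ : IsSmooth f₁) (h₂ : IsSmooth f₂) : IsSmooth (f₁ * f₂) := by
  obtain ⟨F, hF, h⟩ := h₁
  obtain ⟨G, hG, h'⟩ := h₂
  exact ⟨F * G, hF.mul hG, fun g => by simp [h, h']⟩

theorem const (c : ℝ) : IsSmooth fun _ => c := ⟨fun _ => c, contDiff_const, fun _ => rfl⟩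

theorem smul (c : ℝ) (hf : IsSmooth f) : IsSmooth (c • f) := (const c).mul hf

theorem continuous (hf : IsSmooth f) : Continuous f := by
  obtain ⟨F, hF, h⟩ := hf
  have : f = fun g => F (entries g) := funext h
  rw [this]
  exact hF.continuous.comp continuous_entries

theorem comp_mul_left (hf : IsSmooth f) (h : SU2) : IsSmooth fun g => f (h * g) := by
  obtain ⟨F, hF, hfF⟩ := hf
  refine ⟨fun M => F fun i j => (h : Matrix (Fin 2) (Fin 2) ℂ) i 0 * M 0 j +
    (h : Matrix (Fin 2) (Fin 2) ℂ) i 1 * M 1 j, hF.comp (by fun_prop), fun g => ?_⟩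
  change f (h * g) = _
  rw [hfF]
  change F _ = F _
  congr 1
  ext i j
  simp [Matrix.mul_apply, Fin.sum_univ_two]

theorem vectorField_add (h₁ : IsSmooth f₁) (h₂ : IsSmooth f₂) {x y : ℝ} (h : x ^ 2 + y ^ 2 = 1) :
    SU2.vectorField x y 0 (f₁ + f₂) = SU2.vectorField x y 0 f₁ + SU2.vectorField x y 0 f₂ := by
  ext g
  rw [vectorField_eq]
  exact ((h₁.hasDerivAt_zero h g).add (h₂.hasDerivAt_zero h g)).deriv

theorem vectorField_mul (h₁ : IsSmooth f₁) (h₂ : IsSmooth f₂) {x y : ℝ} (h : x ^ 2 + y ^ 2 = 1) :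
    SU2.vectorField x y 0 (f₁ * f₂) =
      SU2.vectorField x y 0 f₁ * f₂ + f₁ * SU2.vectorField x y 0 f₂ := by
  ext g
  rw [vectorField_eq]
  have := ((h₁.hasDerivAt_zero h g).fun_mul (h₂.hasDerivAt_zero h g)).deriv
  simpa [flow_zero] using this

end IsSmooth

theorem vectorField_smul (c : ℝ) (f : SU2 → ℝ) (x y : ℝ) :
    vectorField x y 0 (c • f) = c • vectorField x y 0 f := by
  ext g
  simp [vectorField_eq, deriv_const_mul_field]

theorem vectorField_comp_mul_left (f : SU2 → ℝ) (h : SU2) (x y : ℝ) :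
    vectorField x y 0 (fun g => f (h * g)) = fun g => vectorField x y 0 f (h * g) := by
  ext g
  simp [vectorField_eq, mul_assoc]

theorem sublaplacian_eq (f : SU2 → ℝ) : sublaplacian f =
    vectorField 1 0 0 (vectorField 1 0 0 f) + vectorField 0 1 0 (vectorField 0 1 0 f) := rfl

theorem sublaplacian_smul (c : ℝ) (f : SU2 → ℝ) : sublaplacian (c • f) = c • sublaplacian f := by
  simp only [sublaplacian_eq, vectorField_smul, smul_add]

theorem sublaplacian_comp_mul_left (f : SU2 → ℝ) (h : SU2) :
    sublaplacian (fun g => f (h * g)) = fun g => sublaplacian f (h * g) := by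
  ext g
  simp only [sublaplacian, vectorField_comp_mul_left]

theorem X_unit : (1 : ℝ) ^ 2 + 0 ^ 2 = 1 := by norm_num

theorem Y_unit : (0 : ℝ) ^ 2 + 1 ^ 2 = 1 := by norm_num

theorem IsSmooth.sublaplacian {f : SU2 → ℝ} (hf : IsSmooth f) : IsSmooth (sublaplacian f) :=
  ((hf.vectorField X_unit).vectorField X_unit).add ((hf.vectorField Y_unit).vectorField Y_unit)

theorem IsSmooth.sublaplacian_add {f₁ f₂ : SU2 → ℝ} (h₁ : IsSmooth f₁) (h₂ : IsSmooth f₂) :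
    SU2.sublaplacian (f₁ + f₂) = SU2.sublaplacian f₁ + SU2.sublaplacian f₂ := by
  simp only [sublaplacian_eq, h₁.vectorField_add h₂ X_unit, h₁.vectorField_add h₂ Y_unit,
    (h₁.vectorField X_unit).vectorField_add (h₂.vectorField X_unit) X_unit,
    (h₁.vectorField Y_unit).vectorField_add (h₂.vectorField Y_unit) Y_unit]
  abel

/-! ### Haar measure, integration by parts and the maximum principle -/

instance : haar.IsHaarMeasure := inferInstanceAs (MeasureTheory.Measure.haarMeasure ⊤).IsHaarMeasure

instance : MeasureTheory.IsProbabilityMeasure haar := ⟨by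
  have := MeasureTheory.Measure.haarMeasure_self (K₀ := (⊤ : TopologicalSpace.PositiveCompacts SU2))
  simpa [haar] using this⟩

instance : haar.Regular := inferInstanceAs (MeasureTheory.Measure.haarMeasure ⊤).Regular

/-- A right translate of the Haar measure is again a Haar probability measure, and there is only
one. -/
instance : haar.IsMulRightInvariant := ⟨fun g => by
  have : MeasureTheory.IsProbabilityMeasure (haar.map (· * g)) :=
    MeasureTheory.Measure.isProbabilityMeasure_map (measurable_mul_const g).aemeasurable
  exact MeasureTheory.Measure.isHaarMeasure_eq_of_isProbabilityMeasure _ _⟩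

theorem integrable_of_continuous {E : Type*} [NormedAddCommGroup E] [NormedSpace ℝ E]
    {f : SU2 → E} (hf : Continuous f) : MeasureTheory.Integrable f haar :=
  hf.integrable_of_hasCompactSupport (HasCompactSupport.of_compactSpace f)

theorem exists_norm_le {E : Type*} [NormedAddCommGroup E]
    {f : SU2 → E} (hf : Continuous f) : ∃ C, ∀ g, ‖f g‖ ≤ C := by
  obtain ⟨g, hg⟩ := hf.norm.exists_forall_ge_of_hasCompactSupport (HasCompactSupport.of_compactSpace _)
  exact ⟨_, hg⟩

-- By right invariance the integral of `f` translated along the flow is constant in time;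
-- differentiating under the integral sign at 0 gives the claim. Applied to a product it becomes
-- integration by parts.
open MeasureTheory in
theorem integral_eq_zero_of_hasDerivAt {x y : ℝ} (h : x ^ 2 + y ^ 2 = 1) {E : Type*}
    [NormedAddCommGroup E] [NormedSpace ℝ E] {f f' : SU2 → E}
    (hf : Continuous f) (hf' : Continuous f')
    (hd : ∀ g, HasDerivAt (fun s => f (g * flow x y s)) (f' g) 0) : ∫ g, f' g ∂haar = 0 := by
  obtain ⟨C, hC⟩ := exists_norm_le hf'
  have key := (hasDerivAt_integral_of_dominated_loc_of_deriv_le (μ := haar) (𝕜 := ℝ)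
    (F := fun s g => f (g * flow x y s)) (F' := fun s g => f' (g * flow x y s)) (x₀ := 0)
    (bound := fun _ => C) Filter.univ_mem
    (Filter.Eventually.of_forall fun s =>
      (integrable_of_continuous (hf.comp (continuous_mul_const (flow x y _)))).aestronglyMeasurable)
    (integrable_of_continuous (hf.comp (continuous_mul_const (flow x y _))))
    (integrable_of_continuous (hf'.comp (continuous_mul_const (flow x y _)))).aestronglyMeasurable
    (Filter.Eventually.of_forall fun g s _ => hC _) (integrable_const C)
    (Filter.Eventually.of_forall fun g s _ => hasDerivAt_flow h hd g s)).2
  simp only [integral_mul_right_eq_self, flow_zero] at key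
  simpa using key.unique (hasDerivAt_const 0 _)

theorem IsSmooth.integral_vectorField_mul {f₁ f₂ : SU2 → ℝ} (h₁ : IsSmooth f₁)
    (h₂ : IsSmooth f₂) {x y : ℝ} (h : x ^ 2 + y ^ 2 = 1) :
    ∫ g, SU2.vectorField x y 0 f₁ g * f₂ g ∂haar =
      -∫ g, f₁ g * SU2.vectorField x y 0 f₂ g ∂haar := by
  have h0 := integral_eq_zero_of_hasDerivAt h (h₁.mul h₂).continuous
    ((h₁.mul h₂).vectorField h).continuous ((h₁.mul h₂).hasDerivAt_zero h)
  rw [h₁.vectorField_mul h₂ h] at h0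
  simp only [Pi.add_apply, Pi.mul_apply] at h0
  rw [MeasureTheory.integral_add] at h0
  · linarith
  · exact integrable_of_continuous ((h₁.vectorField h).mul h₂).continuous
  · exact integrable_of_continuous (h₁.mul (h₂.vectorField h)).continuous

/-- The sublaplacian is symmetric. -/
theorem IsSmooth.integral_sublaplacian_mul {f₁ f₂ : SU2 → ℝ} (h₁ : IsSmooth f₁)
    (h₂ : IsSmooth f₂) :
    ∫ g, SU2.sublaplacian f₁ g * f₂ g ∂haar = ∫ g, f₁ g * SU2.sublaplacian f₂ g ∂haar := by
  have key : ∀ {x y : ℝ}, x ^ 2 + y ^ 2 = 1 →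
      ∫ g, SU2.vectorField x y 0 (SU2.vectorField x y 0 f₁) g * f₂ g ∂haar =
      ∫ g, f₁ g * SU2.vectorField x y 0 (SU2.vectorField x y 0 f₂) g ∂haar := by
    intro x y h
    rw [(h₁.vectorField h).integral_vectorField_mul h₂ h,
      h₁.integral_vectorField_mul (h₂.vectorField h) h, neg_neg]
  simp only [sublaplacian_eq, Pi.add_apply, add_mul, mul_add]
  rw [MeasureTheory.integral_add, MeasureTheory.integral_add, key X_unit, key Y_unit]
  · exact integrable_of_continuous (h₁.mul ((h₂.vectorField X_unit).vectorField X_unit)).continuous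
  · exact integrable_of_continuous (h₁.mul ((h₂.vectorField Y_unit).vectorField Y_unit)).continuous
  · exact integrable_of_continuous (((h₁.vectorField X_unit).vectorField X_unit).mul h₂).continuous
  · exact integrable_of_continuous (((h₁.vectorField Y_unit).vectorField Y_unit).mul h₂).continuous

/-- Second derivative test along the flow: a positive second derivative would make 0 a local minimum
as well as a local maximum, so the function would be locally constant and its second derivative
zero. -/
theorem IsSmooth.vectorField_vectorField_nonpos {f : SU2 → ℝ} (hf : IsSmooth f) {g : SU2}
    (hg : ∀ h, f h ≤ f g) {x y : ℝ} (h : x ^ 2 + y ^ 2 = 1) :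
    SU2.vectorField x y 0 (SU2.vectorField x y 0 f) g ≤ 0 := by
  by_contra! hpos
  set u : ℝ → ℝ := fun s => f (g * flow x y s) with hu
  have hd : deriv u = fun s => SU2.vectorField x y 0 f (g * flow x y s) :=
    funext fun s => (hf.hasDerivAt h g s).deriv
  have hmax : IsLocalMax u 0 := Filter.Eventually.of_forall fun s => by
    simpa [hu, flow_zero] using hg _
  have hdd : deriv (deriv u) 0 = SU2.vectorField x y 0 (SU2.vectorField x y 0 f) g := by
    rw [hd, ← vectorField_eq]
  have hmin : IsLocalMin u 0 := isLocalMin_of_deriv_deriv_pos (hdd ▸ hpos) hmax.deriv_eq_zero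
    (hf.hasDerivAt h g 0).continuousAt
  have hconst : u =ᶠ[𝓝 0] fun _ => u 0 := by
    filter_upwards [hmax, hmin] with s h1 h2 using le_antisymm h1 h2
  have h0 : deriv (deriv u) 0 = 0 := by
    rw [hconst.deriv.deriv_eq]
    simp
  rw [hdd] at h0
  exact hpos.ne' h0

/-- The maximum principle for the sublaplacian. -/
theorem IsSmooth.sublaplacian_nonpos {f : SU2 → ℝ} (hf : IsSmooth f) {g : SU2}
    (hg : ∀ h, f h ≤ f g) : SU2.sublaplacian f g ≤ 0 :=
  add_nonpos (hf.vectorField_vectorField_nonpos hg X_unit)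
    (hf.vectorField_vectorField_nonpos hg Y_unit)

/-! ### The sublaplacian on monomials -/

/-- The monomial `α^p (conj α)^q β^r (conj β)^s`. -/
noncomputable def mon (p q r s : ℕ) (g : SU2) : ℂ :=
  α g ^ p * conj (α g) ^ q * β g ^ r * conj (β g) ^ s

theorem continuous_mon (p q r s : ℕ) : Continuous (mon p q r s) := by
  have := continuous_α
  have := continuous_β
  have := Complex.continuous_conj
  unfold mon
  fun_prop

theorem conj_mon (p q r s : ℕ) (g : SU2) : conj (mon p q r s g) = mon q p s r g := by
  simp only [mon, map_mul, map_pow, Complex.conj_conj]; ring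

theorem mon_mul (p q r s p' q' r' s' : ℕ) (g : SU2) :
    mon p q r s g * mon p' q' r' s' g = mon (p + p') (q + q') (r + r') (s + s') g := by
  simp only [mon]; ring

theorem isSmooth_re_mon (c : ℂ) (p q r s : ℕ) : IsSmooth fun g => (c * mon p q r s g).re := by
  refine ⟨fun M => (c * (M 0 0 ^ p * conj (M 0 0) ^ q * M 0 1 ^ r * conj (M 0 1) ^ s)).re, ?_,
    fun g => rfl⟩
  have hc : ContDiff ℝ ∞ (fun z : ℂ => conj z) := Complex.conjCLE.contDiff
  have h0 : ContDiff ℝ ∞ (fun M : Fin 2 → Fin 2 → ℂ => conj (M 0 0)) := hc.comp (by fun_prop)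
  have h1 : ContDiff ℝ ∞ (fun M : Fin 2 → Fin 2 → ℂ => conj (M 0 1)) := hc.comp (by fun_prop)
  have h2 : ContDiff ℝ ∞ (fun M : Fin 2 → Fin 2 → ℂ =>
      c * (M 0 0 ^ p * conj (M 0 0) ^ q * M 0 1 ^ r * conj (M 0 1) ^ s)) := by fun_prop
  exact Complex.reCLM.contDiff.comp h2

/-- `F'` is the derivative of the complex valued function `F` along `x X + y Y`. -/
def HasVF (x y : ℝ) (F F' : SU2 → ℂ) : Prop :=
  ∀ g, HasDerivAt (fun t => F (g * flow x y t)) (F' g) 0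

theorem HasVF.add {x y : ℝ} {F F' G G' : SU2 → ℂ} (hF : HasVF x y F F') (hG : HasVF x y G G') :
    HasVF x y (F + G) (F' + G') := fun g => (hF g).add (hG g)

theorem HasVF.smul {x y : ℝ} {F F' : SU2 → ℂ} (c : ℂ) (hF : HasVF x y F F') :
    HasVF x y (c • F) (c • F') := fun g => (hF g).const_mul c

theorem HasVF.conj {x y : ℝ} {F F' : SU2 → ℂ} (hF : HasVF x y F F') :
    HasVF x y (fun g => conj (F g)) (fun g => conj (F' g)) := fun g =>
  Complex.conjCLE.toContinuousLinearMap.hasFDerivAt.comp_hasDerivAt (0 : ℝ) (hF g)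

theorem HasVF.re {x y : ℝ} {F F' : SU2 → ℂ} (hF : HasVF x y F F') :
    vectorField x y 0 (fun g => (F g).re) = fun g => (F' g).re := by
  ext g
  rw [vectorField_eq]
  exact (Complex.reCLM.hasFDerivAt.comp_hasDerivAt (0 : ℝ) (hF g)).deriv

theorem hasVF_α {x y : ℝ} (h : x ^ 2 + y ^ 2 = 1) :
    HasVF x y α (fun g => -conj (x + Complex.I * y : ℂ) * β g) := by
  intro g
  simp only [α_mul, flow, α_exp_horizontal h, β_exp_horizontal h]
  have h1 := ((Real.hasDerivAt_cos 0).ofReal_comp.const_mul (α g)).sub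
    (((Real.hasDerivAt_sin 0).ofReal_comp.const_mul (conj (x + Complex.I * y : ℂ))).const_mul (β g))
  simp only [map_mul, Complex.conj_ofReal]
  refine h1.congr_deriv ?_
  simp; ring

theorem hasVF_β {x y : ℝ} (h : x ^ 2 + y ^ 2 = 1) :
    HasVF x y β (fun g => (x + Complex.I * y : ℂ) * α g) := by
  intro g
  simp only [β_mul, flow, α_exp_horizontal h, β_exp_horizontal h]
  have h1 := (((Real.hasDerivAt_sin 0).ofReal_comp.const_mul (x + Complex.I * y : ℂ)).const_mul
    (α g)).add ((Real.hasDerivAt_cos 0).ofReal_comp.const_mul (β g))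
  simp only [Complex.conj_ofReal]
  refine h1.congr_deriv ?_
  simp; ring

/-- The image of a monomial under the derivation `β ∂_α - (conj α) ∂_(conj β)`. -/
noncomputable def monU (p q r s : ℕ) : SU2 → ℂ :=
  (p : ℂ) • mon (p - 1) q (r + 1) s + (-(s : ℂ)) • mon p (q + 1) r (s - 1)

/-- The image of a monomial under the derivation `α ∂_β - (conj β) ∂_(conj α)`. -/
noncomputable def monV (p q r s : ℕ) : SU2 → ℂ :=
  (r : ℂ) • mon (p + 1) q (r - 1) s + (-(q : ℂ)) • mon p (q - 1) r (s + 1)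

theorem hasVF_mon {x y : ℝ} (h : x ^ 2 + y ^ 2 = 1) (p q r s : ℕ) :
    HasVF x y (mon p q r s) ((-conj (x + Complex.I * y : ℂ)) • monU p q r s +
      (x + Complex.I * y : ℂ) • monV p q r s) := by
  intro g
  have h1 := ((((hasVF_α h g).fun_pow p).fun_mul ((hasVF_α h).conj g |>.fun_pow q)).fun_mul
    ((hasVF_β h g).fun_pow r)).fun_mul ((hasVF_β h).conj g |>.fun_pow s)
  refine h1.congr_deriv ?_
  simp only [flow_zero, mul_one, monU, monV, mon, Pi.add_apply, Pi.smul_apply, smul_eq_mul, map_mul,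
    map_neg, Complex.conj_conj]
  ring

/-- `G` is the image of the complex valued function `F` under the sublaplacian. -/
def HasLap (F G : SU2 → ℂ) : Prop :=
  ∃ F₁ F₂ G₁ G₂, HasVF 1 0 F F₁ ∧ HasVF 1 0 F₁ G₁ ∧ HasVF 0 1 F F₂ ∧ HasVF 0 1 F₂ G₂ ∧ G = G₁ + G₂

theorem HasLap.add {F G F' G' : SU2 → ℂ} : HasLap F G → HasLap F' G' → HasLap (F + F') (G + G') := by
  rintro ⟨F₁, F₂, G₁, G₂, h1, h2, h3, h4, rfl⟩ ⟨F₁', F₂', G₁', G₂', h1', h2', h3', h4', rfl⟩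
  exact ⟨_, _, _, _, h1.add h1', h2.add h2', h3.add h3', h4.add h4', by abel⟩

theorem HasLap.smul {F G : SU2 → ℂ} (c : ℂ) : HasLap F G → HasLap (c • F) (c • G) := by
  rintro ⟨F₁, F₂, G₁, G₂, h1, h2, h3, h4, rfl⟩
  exact ⟨_, _, _, _, h1.smul c, h2.smul c, h3.smul c, h4.smul c, smul_add _ _ _⟩

theorem HasLap.sum {ι : Type*} (t : Finset ι) {F G : ι → SU2 → ℂ}
    (h : ∀ i ∈ t, HasLap (F i) (G i)) : HasLap (∑ i ∈ t, F i) (∑ i ∈ t, G i) := by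
  classical
  induction t using Finset.induction_on with
  | empty =>
    have h0 : ∀ x y, HasVF x y (0 : SU2 → ℂ) 0 := fun x y g => hasDerivAt_const _ _
    exact ⟨0, 0, 0, 0, h0 _ _, h0 _ _, h0 _ _, h0 _ _, by simp⟩
  | insert a t ha ih =>
    rw [Finset.sum_insert ha, Finset.sum_insert ha]
    exact (h a (by simp)).add (ih fun i hi => h i (by simp [hi]))

theorem HasLap.re {F G : SU2 → ℂ} : HasLap F G →
    sublaplacian (fun g => (F g).re) = fun g => (G g).re := by
  rintro ⟨F₁, F₂, G₁, G₂, h1, h2, h3, h4, rfl⟩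
  rw [sublaplacian_eq, h1.re, h2.re, h3.re, h4.re]
  ext g
  simp

/-- With U and V the derivations behind `monU` and `monV`, one has X = V - U and Y = i(U + V), so
that X² + Y² = -2(UV + VU). -/
theorem hasLap_mon (p q r s : ℕ) : HasLap (mon p q r s)
    ((-2 * (r * (p + 1) + q * (s + 1) + p * (r + 1) + s * (q + 1)) : ℂ) • mon p q r s +
      ((4 * r * s : ℂ) • mon (p + 1) (q + 1) (r - 1) (s - 1) +
      (4 * p * q : ℂ) • mon (p - 1) (q - 1) (r + 1) (s + 1))) := by
  refine ⟨_, _, _, _, hasVF_mon X_unit p q r s,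
    (((hasVF_mon X_unit _ _ _ _).smul _).add ((hasVF_mon X_unit _ _ _ _).smul _)).smul _ |>.add
    ((((hasVF_mon X_unit _ _ _ _).smul _).add ((hasVF_mon X_unit _ _ _ _).smul _)).smul _),
    hasVF_mon Y_unit p q r s,
    (((hasVF_mon Y_unit _ _ _ _).smul _).add ((hasVF_mon Y_unit _ _ _ _).smul _)).smul _ |>.add
    ((((hasVF_mon Y_unit _ _ _ _).smul _).add ((hasVF_mon Y_unit _ _ _ _).smul _)).smul _), ?_⟩
  ext g
  have hI := Complex.I_sq
  -- The truncated exponents are harmless because a zero exponent comes with a zero coefficient;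
  -- splitting on zero lets `ring` see this.
  rcases p with _ | p <;> rcases q with _ | q <;> rcases r with _ | r <;> rcases s with _ | s <;>
    simp [monU, monV] <;> ring_nf <;> (try simp only [hI]) <;> (try ring)

/-! ### Integrals of monomials -/

open MeasureTheory in
-- Right and left translation by exp(zZ) multiply the monomial by the phases e^{i(p-q-r+s)z} and
-- e^{i(p-q+r-s)z}. One of the two integers N is nonzero, and z = π/N turns that phase into -1.
theorem integral_mon_eq_zero {p q r s : ℕ} (h : p ≠ q ∨ r ≠ s) :
    ∫ g, mon p q r s g ∂haar = 0 := by
  have hexp : ∀ N : ℤ, N ≠ 0 → Complex.exp (Complex.I * (Real.pi / N : ℝ)) ^ N = -1 := by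
    intro N hN
    rw [← Complex.exp_int_mul, ← Complex.exp_pi_mul_I]
    have : (N : ℂ) ≠ 0 := by exact_mod_cast hN
    congr 1
    push_cast
    field_simp
  have hne : ∀ z : ℝ, Complex.exp (Complex.I * z) ≠ 0 := fun z => Complex.exp_ne_zero _
  have hconj : ∀ z : ℝ, conj (Complex.exp (Complex.I * z)) = (Complex.exp (Complex.I * z))⁻¹ := by
    intro z
    rw [← Complex.exp_conj, ← Complex.exp_neg]
    simp
  have hneg : ∀ I : ℂ, I = -I → I = 0 := fun I hI => by linear_combination hI / 2
  by_cases h1 : (p : ℤ) - q + r - s = 0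
  · have h2 : (p : ℤ) - q - r + s ≠ 0 := by omega
    set z : ℝ := Real.pi / ((p : ℤ) - q - r + s : ℤ) with hz
    have key : ∀ g, mon p q r s (g * SU2.exp 0 0 z) = -mon p q r s g := by
      intro g
      simp only [mon, α_mul, β_mul, α_exp_vertical, β_exp_vertical, map_zero, mul_zero, sub_zero,
        map_mul, hconj, zero_add, map_inv₀, inv_inv]
      have := hexp _ h2
      rw [← hz, zpow_add₀ (hne z), zpow_sub₀ (hne z), zpow_sub₀ (hne z)] at this
      simp only [zpow_natCast] at this
      simp only [mul_pow, inv_pow]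
      rw [neg_eq_neg_one_mul, ← this]
      ring
    apply hneg
    conv_lhs => rw [← integral_mul_right_eq_self (μ := haar) _ (SU2.exp 0 0 z)]
    simp only [key]
    rw [integral_neg]
  · set z : ℝ := Real.pi / ((p : ℤ) - q + r - s : ℤ) with hz
    have key : ∀ g, mon p q r s (SU2.exp 0 0 z * g) = -mon p q r s g := by
      intro g
      simp only [mon, α_mul, β_mul, α_exp_vertical, β_exp_vertical, zero_mul, sub_zero,
        map_mul, hconj, add_zero]
      have := hexp _ h1
      rw [← hz, zpow_sub₀ (hne z), zpow_add₀ (hne z), zpow_sub₀ (hne z)] at this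
      simp only [zpow_natCast] at this
      simp only [mul_pow, inv_pow]
      rw [neg_eq_neg_one_mul, ← this]
      ring
    apply hneg
    conv_lhs => rw [← integral_mul_left_eq_self (μ := haar) _ (SU2.exp 0 0 z)]
    simp only [key]
    rw [integral_neg]

theorem mon_succ_add (p q r s : ℕ) (g : SU2) :
    mon (p + 1) (q + 1) r s g + mon p q (r + 1) (s + 1) g = mon p q r s g := by
  have := α_mul_conj_add g
  simp only [mon]
  linear_combination (α g ^ p * conj (α g) ^ q * β g ^ r * conj (β g) ^ s) * this

theorem integrable_mon (p q r s : ℕ) : MeasureTheory.Integrable (mon p q r s) haar :=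
  integrable_of_continuous (continuous_mon p q r s)

theorem integral_mon_succ_add (p q r s : ℕ) :
    ∫ g, mon (p + 1) (q + 1) r s g ∂haar + ∫ g, mon p q (r + 1) (s + 1) g ∂haar =
      ∫ g, mon p q r s g ∂haar := by
  rw [← MeasureTheory.integral_add (integrable_mon _ _ _ _) (integrable_mon _ _ _ _)]
  simp only [mon_succ_add]

/-- Obtained by integrating the X-derivative of α^{i+1} ᾱ^i β^s β̄^{s+1}, whose integral is zero;
the two other terms of the derivative have unbalanced exponents and integrate to zero. -/
theorem integral_mon_recurrence (i s : ℕ) :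
    ((s : ℂ) + 1) * ∫ g, mon (i + 1) (i + 1) s s g ∂haar =
      ((i : ℂ) + 1) * ∫ g, mon i i (s + 1) (s + 1) g ∂haar := by
  have hd : ∀ g, HasDerivAt (fun t => mon (i + 1) i s (s + 1) (g * flow 1 0 t))
      ((s + 1 : ℂ) * mon (i + 1) (i + 1) s s g - (i + 1 : ℂ) * mon i i (s + 1) (s + 1) g +
        (s * mon (i + 2) i (s - 1) (s + 1) g - i * mon (i + 1) (i - 1) s (s + 2) g)) 0 := by
    intro g
    refine (hasVF_mon X_unit (i + 1) i s (s + 1) g).congr_deriv ?_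
    simp [monU, monV]
    ring
  have C := continuous_mon
  have I := fun (c : ℂ) p q r s => (integrable_mon p q r s).const_mul c
  have h0 := integral_eq_zero_of_hasDerivAt X_unit (C _ _ _ _) (by fun_prop) hd
  rw [MeasureTheory.integral_add, MeasureTheory.integral_sub, MeasureTheory.integral_sub] at h0
  · simp only [MeasureTheory.integral_const_mul] at h0
    rw [integral_mon_eq_zero (p := i + 2) (q := i) (by omega),
      integral_mon_eq_zero (p := i + 1) (q := i - 1) (by omega)] at h0
    linear_combination h0
  · exact I _ _ _ _ _
  · exact I _ _ _ _ _
  · exact I _ _ _ _ _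
  · exact I _ _ _ _ _
  · exact (I _ _ _ _ _).sub (I _ _ _ _ _)
  · exact (I _ _ _ _ _).sub (I _ _ _ _ _)

/-- A Beta integral. The relation |α|² + |β|² = 1 lowers s; at s = 0 it is combined with the
recurrence to give 1/(i + 1). -/
theorem integral_mon_diag (i s : ℕ) : ∫ g, mon i i s s g ∂haar =
    (i.factorial * s.factorial : ℂ) / ((i + s + 1).factorial : ℂ) := by
  induction s generalizing i with
  | zero =>
    induction i with
    | zero => simp [mon]
    | succ i ih =>
      have h1 := integral_mon_recurrence i 0
      have h2 := integral_mon_succ_add i i 0 0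
      rw [ih] at h2
      have h3 : ((i : ℂ) + 2) * ∫ g, mon (i + 1) (i + 1) 0 0 g ∂haar =
          (i + 1) * (i.factorial * Nat.factorial 0 / ((i + 0 + 1).factorial : ℂ)) := by
        rw [← h2]
        linear_combination h1
      have h4 : (i : ℂ) + 2 ≠ 0 := by exact_mod_cast (by omega : i + 2 ≠ 0)
      apply mul_left_cancel₀ h4
      rw [h3]
      simp only [add_zero, Nat.factorial_succ, Nat.factorial_zero]
      have h5 : (i.factorial : ℂ) ≠ 0 := by exact_mod_cast i.factorial_ne_zero
      have h6 : (i : ℂ) + 1 ≠ 0 := by exact_mod_cast (by omega : i + 1 ≠ 0)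
      push_cast
      have h7 : (i : ℂ) + 1 + 1 ≠ 0 := by rw [add_assoc]; norm_num; exact h4
      field_simp
      ring
  | succ s ih =>
    have h2 := integral_mon_succ_add i i s s
    rw [ih, ih] at h2
    rw [eq_sub_of_add_eq' h2]
    rw [show i + 1 + s + 1 = (i + s + 1) + 1 by ring, show i + (s + 1) + 1 = (i + s + 1) + 1 by ring]
    simp only [Nat.factorial_succ (i + s + 1), Nat.factorial_succ i, Nat.factorial_succ s]
    have h5 : ((i + s + 1).factorial : ℂ) ≠ 0 := by exact_mod_cast Nat.factorial_ne_zero _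
    have h6 : (i : ℂ) + s + 1 + 1 ≠ 0 := by exact_mod_cast (by omega : i + s + 1 + 1 ≠ 0)
    push_cast
    field_simp
    ring

/-- The left side is the k-th forward difference of x ↦ C(x, p) at M, and each difference lowers the
index p by one. -/
theorem alternating_sum_choose (k p M : ℕ) :
    ∑ s ∈ Finset.range (k + 1), (-1 : ℤ) ^ s * (k.choose s) * ((M + (k - s)).choose p) =
      if k ≤ p then (M.choose (p - k) : ℤ) else 0 := by
  have h := fwdDiff_iter_eq_sum_shift (1 : ℕ) (fun x ↦ x.choose p : ℕ → ℤ) k M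
  have h2 : (fwdDiff 1)^[k] (fun x ↦ x.choose p : ℕ → ℤ) M =
      if k ≤ p then (M.choose (p - k) : ℤ) else 0 := by
    split_ifs with hk
    · obtain ⟨j, rfl⟩ := Nat.exists_eq_add_of_le hk
      rw [fwdDiff_iter_choose]
      simp
    · obtain ⟨m, rfl⟩ := Nat.exists_eq_add_of_lt (not_le.mp hk)
      rw [show p + m + 1 = (m + 1) + p by ring, Function.iterate_add_apply]
      have := fwdDiff_iter_choose 0 p
      rw [add_zero] at this
      rw [this, Function.iterate_succ_apply]
      have h0 : fwdDiff 1 (fun x ↦ (x.choose 0 : ℤ) : ℕ → ℤ) = fun _ => 0 := by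
        ext x
        simp [fwdDiff]
      have h1 : fwdDiff 1 (fun _ ↦ 0 : ℕ → ℤ) = fun _ => 0 := by
        ext x
        simp [fwdDiff]
      rw [h0, Function.iterate_fixed h1]
  rw [← h2, h, ← Finset.sum_flip]
  refine Finset.sum_congr rfl fun s hs => ?_
  have hs' : s ≤ k := Nat.lt_succ_iff.mp (Finset.mem_range.mp hs)
  simp [Nat.choose_symm hs', Nat.sub_sub_self hs']

/-! ### Zonal functions: eigenvalue, bound and pairings -/

/-- The coefficients of the zonal functions in terms of monomials. -/
def phiCoeff (n k s : ℕ) : ℤ := (-1) ^ s * (n + k).choose s * k.choose s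

/-- The zonal function of weight `n ≥ 0` in the irreducible representation of dimension
`2 k + n + 1`. -/
noncomputable def phi (n k : ℕ) : SU2 → ℂ :=
  ∑ s ∈ Finset.range (k + 1), (phiCoeff n k s : ℂ) • mon (n + k - s) (k - s) s s

/-- The eigenvalue of minus the sublaplacian on the zonal functions. -/
noncomputable def eigenvalue (n k : ℕ) : ℝ := 4 * k * (k + n + 1) + 2 * n

/-- The hypergeometric ratio of consecutive coefficients. It balances the terms by which the
sublaplacian moves s to s - 1 and s + 1, which makes `phi` an eigenfunction. -/
theorem phiCoeff_succ {n k s : ℕ} (hs : s ≤ k) : (phiCoeff n k (s + 1) : ℂ) * (s + 1) ^ 2 =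
    -(((n : ℂ) + k - s) * ((k : ℂ) - s) * phiCoeff n k s) := by
  have h1 := Nat.choose_succ_right_eq (n + k) s
  have h2 := Nat.choose_succ_right_eq k s
  have h1' : ((n + k).choose (s + 1) : ℂ) * (s + 1) = (n + k).choose s * (n + k - s) := by
    rw [← Nat.cast_add n k, ← Nat.cast_sub (by omega : s ≤ n + k)]
    exact_mod_cast h1
  have h2' : (k.choose (s + 1) : ℂ) * (s + 1) = k.choose s * (k - s) := by
    rw [← Nat.cast_sub hs]
    exact_mod_cast h2
  simp only [phiCoeff, pow_succ]
  push_cast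
  linear_combination (-(-1) ^ s * (k.choose (s + 1) : ℂ) * (s + 1)) * h1' -
    ((-1) ^ s * ((n + k).choose s : ℂ) * (n + k - s)) * h2'

theorem phiCoeff_recurrence (n k : ℕ) (m : ℕ → ℂ) :
    ∑ s ∈ Finset.range (k + 1), (phiCoeff n k s : ℂ) *
      (-2 * (2 * s * (n + k - s + (k - s)) + 2 * s + (n + k - s) + (k - s)) * m s +
        (4 * s * s * m (s - 1) + 4 * (n + k - s) * (k - s) * m (s + 1))) =
    -(eigenvalue n k) * ∑ s ∈ Finset.range (k + 1), (phiCoeff n k s : ℂ) * m s := by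
  -- Shifting the index sends the neighbouring terms back to `m s`. The boundary terms vanish,
  -- through the factor s at s = 0 and k - s at s = k.
  have h1 : ∑ s ∈ Finset.range (k + 1), (phiCoeff n k s : ℂ) * (4 * s * s * m (s - 1)) =
      ∑ s ∈ Finset.range (k + 1), (phiCoeff n k s : ℂ) * (-4 * (n + k - s) * (k - s) * m s) := by
    rw [Finset.sum_range_succ', Finset.sum_range_succ]
    simp only [Nat.cast_zero, mul_zero, zero_mul, add_zero, sub_self]
    refine Finset.sum_congr rfl fun s hs => ?_
    have := phiCoeff_succ (n := n) (Finset.mem_range.mp hs).le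
    simp only [Nat.add_sub_cancel]
    push_cast
    linear_combination 4 * m s * this
  have h2 : ∑ s ∈ Finset.range (k + 1), (phiCoeff n k s : ℂ) *
        (4 * (n + k - s) * (k - s) * m (s + 1)) =
      ∑ s ∈ Finset.range (k + 1), (phiCoeff n k s : ℂ) * (-4 * s * s * m s) := by
    rw [Finset.sum_range_succ, Finset.sum_range_succ']
    simp only [Nat.cast_zero, mul_zero, zero_mul, add_zero, sub_self]
    refine Finset.sum_congr rfl fun s hs => ?_
    have := phiCoeff_succ (n := n) (Finset.mem_range.mp hs).le
    push_cast
    linear_combination 4 * m (s + 1) * this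
  simp only [mul_add, Finset.sum_add_distrib] at h1 h2 ⊢
  rw [h1, h2, Finset.mul_sum]
  simp only [← Finset.sum_add_distrib]
  refine Finset.sum_congr rfl fun s _ => ?_
  simp only [eigenvalue]
  push_cast
  ring

theorem hasLap_phi (n k : ℕ) : HasLap (phi n k) ((-(eigenvalue n k) : ℂ) • phi n k) := by
  have h := HasLap.sum (Finset.range (k + 1)) fun s _ =>
    (hasLap_mon (n + k - s) (k - s) s s).smul (phiCoeff n k s : ℂ)
  refine (?_ : (-(eigenvalue n k) : ℂ) • phi n k = _) ▸ h
  ext g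
  have := phiCoeff_recurrence n k fun s => mon (n + k - s) (k - s) s s g
  simp only [phi, Finset.sum_apply, Pi.smul_apply, smul_eq_mul, Pi.add_apply] at this ⊢
  rw [← this]
  refine Finset.sum_congr rfl fun s hs => ?_
  have hs : s ≤ k := Nat.lt_succ_iff.mp (Finset.mem_range.mp hs)
  rw [Nat.cast_sub hs, Nat.cast_sub (by omega : s ≤ n + k), show n + k - s - 1 = n + k - (s + 1) by omega,
    show k - s - 1 = k - (s + 1) by omega]
  rcases s with _ | s
  · push_cast; ring_nf
  · rw [show n + k - (s + 1) + 1 = n + k - (s + 1 - 1) by omega,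
      show k - (s + 1) + 1 = k - (s + 1 - 1) by omega]
    push_cast; ring

theorem phi_apply (n k : ℕ) (g : SU2) : phi n k g =
    ∑ s ∈ Finset.range (k + 1), (phiCoeff n k s : ℂ) * mon (n + k - s) (k - s) s s g := by
  simp [phi]

theorem continuous_phi (n k : ℕ) : Continuous (phi n k) := by
  have := continuous_mon
  simp only [funext (phi_apply n k)]
  fun_prop

-- This exhibits `phi n k` as a matrix coefficient: for f = α^{n+k} β^k and right translation R_g,
-- the inner product of R_g f with f is ‖f‖² times `phi n k g`. Both entries of hg are expanded by
-- the binomial theorem, and only the terms with s = t have balanced exponents.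
open MeasureTheory in
theorem integral_translate_mul_conj (n k : ℕ) (g : SU2) :
    ∫ h, mon (n + k) 0 k 0 (h * g) * conj (mon (n + k) 0 k 0 h) ∂haar =
      (∫ h, mon (n + k) (n + k) k k h ∂haar) * phi n k g := by
  have expand : ∀ h, mon (n + k) 0 k 0 (h * g) * conj (mon (n + k) 0 k 0 h) =
      ∑ t ∈ Finset.range (k + 1), ∑ s ∈ Finset.range (n + k + 1),
        ((-1) ^ s * (n + k).choose s * k.choose t * mon (n + k - s) (k - t) t s g) *
          mon (n + k - s + t) (n + k) (s + (k - t)) k h := by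
    intro h
    have h1 : α (h * g) ^ (n + k) = ∑ s ∈ Finset.range (n + k + 1),
        (-(β h * conj (β g))) ^ s * (α h * α g) ^ (n + k - s) * (n + k).choose s := by
      rw [α_mul, ← add_pow]; ring
    have h2 : β (h * g) ^ k = ∑ t ∈ Finset.range (k + 1),
        (α h * β g) ^ t * (β h * conj (α g)) ^ (k - t) * k.choose t := by
      rw [β_mul, ← add_pow]
    have h3 : mon (n + k) 0 k 0 (h * g) = β (h * g) ^ k * α (h * g) ^ (n + k) := by
      simp [mon]; ring
    rw [conj_mon, h3, h1, h2, Finset.sum_mul_sum, Finset.sum_mul]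
    refine Finset.sum_congr rfl fun t _ => ?_
    rw [Finset.sum_mul]
    refine Finset.sum_congr rfl fun s _ => ?_
    rw [neg_pow]
    simp only [mon, mul_pow, pow_add]
    ring
  have I := fun (c : ℂ) p q r s => (integrable_mon p q r s).const_mul c
  simp only [expand]
  rw [integral_finsetSum _ fun t _ => integrable_finsetSum _ fun s _ => I _ _ _ _ _, phi_apply,
    Finset.mul_sum]
  refine Finset.sum_congr rfl fun t ht => ?_
  have ht : t ≤ k := Nat.lt_succ_iff.mp (Finset.mem_range.mp ht)
  rw [integral_finsetSum _ fun s _ => I _ _ _ _ _]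
  simp only [integral_const_mul]
  rw [Finset.sum_eq_single t]
  · rw [show n + k - t + t = n + k by omega, show t + (k - t) = k by omega]
    simp only [phiCoeff]
    push_cast
    ring
  · intro s hs hst
    have hs : s ≤ n + k := Nat.lt_succ_iff.mp (Finset.mem_range.mp hs)
    rw [integral_mon_eq_zero (by omega), mul_zero]
  · intro h
    exact absurd (Finset.mem_range.mpr (by omega)) h

open MeasureTheory in
theorem norm_phi_le_one (n k : ℕ) (g : SU2) : ‖phi n k g‖ ≤ 1 := by
  set f : SU2 → ℂ := mon (n + k) 0 k 0 with hf
  have hfc : Continuous f := continuous_mon _ _ _ _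
  have hfg : Continuous fun h => f (h * g) := hfc.comp (continuous_mul_const g)
  set B : ℝ := ∫ h, ‖f h‖ ^ 2 ∂haar with hB
  have hBC : (B : ℂ) = ∫ h, mon (n + k) (n + k) k k h ∂haar := by
    rw [hB, ← integral_complex_ofReal]
    congr 1 with h
    rw [Complex.ofReal_pow, ← Complex.mul_conj', hf, conj_mon, mon_mul]
    simp
  have hBpos : 0 < B := by
    rw [integral_mon_diag] at hBC
    have : B = ((n + k).factorial * k.factorial : ℝ) / ((n + k + k + 1).factorial : ℝ) := by
      apply Complex.ofReal_injective
      rw [hBC]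
      push_cast
      ring
    rw [this]
    positivity
  -- Cauchy–Schwarz for the matrix coefficient, in the pointwise form ab ≤ (a² + b²)/2; right
  -- invariance gives both squares the integral `B`.
  have h1 : ‖(B : ℂ) * phi n k g‖ ≤ B := by
    rw [hBC, ← integral_translate_mul_conj]
    have hb : ∫ h, (‖f (h * g)‖ ^ 2 + ‖f h‖ ^ 2) / 2 ∂haar = B := by
      rw [integral_div, integral_add (integrable_of_continuous (by fun_prop))
        (integrable_of_continuous (by fun_prop)),
        integral_mul_right_eq_self (fun h => ‖f h‖ ^ 2) g]
      ring
    rw [← hb]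
    refine norm_integral_le_of_norm_le (integrable_of_continuous (by fun_prop))
      (Filter.Eventually.of_forall fun h => ?_)
    rw [norm_mul, RCLike.norm_conj]
    nlinarith [sq_nonneg (‖f (h * g)‖ - ‖f h‖)]
  rw [norm_mul, Complex.norm_real, Real.norm_of_nonneg hBpos.le] at h1
  nlinarith

-- The Beta integrals reduce the pairing to an alternating binomial sum. It vanishes for k > p, so
-- the expansion of such a monomial is finite.
open MeasureTheory in
theorem integral_phi_mul_mon (n k p : ℕ) : ∫ g, phi n k g * mon p (p + n) 0 0 g ∂haar =
    (p.descFactorial k * (n + p).factorial : ℂ) / ((n + p + k + 1).factorial : ℂ) := by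
  have I := fun (c : ℂ) p q r s => (integrable_mon p q r s).const_mul c
  simp only [phi_apply, Finset.sum_mul, mul_assoc, mon_mul]
  rw [integral_finsetSum _ fun s _ => I _ _ _ _ _]
  simp only [integral_const_mul]
  have h1 : ∀ s ∈ Finset.range (k + 1), (phiCoeff n k s : ℂ) *
      ∫ g, mon (n + k - s + p) (k - s + (p + n)) (s + 0) (s + 0) g ∂haar =
      ((-1) ^ s * (k.choose s) * ((n + p + (k - s)).choose p) : ℤ) *
        (((n + k).factorial * p.factorial : ℂ) / ((n + p + k + 1).factorial : ℂ)) := by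
    intro s hs
    have hs : s ≤ k := Nat.lt_succ_iff.mp (Finset.mem_range.mp hs)
    obtain ⟨j, rfl⟩ := Nat.exists_eq_add_of_le hs
    rw [show n + (s + j) - s + p = n + p + j by omega, show s + j - s + (p + n) = n + p + j by omega,
      show s + 0 = s by omega, show s + j - s = j by omega, integral_mon_diag,
      show n + p + j + s + 1 = n + p + (s + j) + 1 by omega]
    have e1 : (((n + (s + j)).choose s * s.factorial * (n + j).factorial : ℕ) : ℂ) =
        (n + (s + j)).factorial := by
      rw [← Nat.choose_mul_factorial_mul_factorial (by omega : s ≤ n + (s + j)),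
        show n + (s + j) - s = n + j by omega]
    have e2 : (((n + p + j).choose p * p.factorial * (n + j).factorial : ℕ) : ℂ) =
        (n + p + j).factorial := by
      rw [← Nat.choose_mul_factorial_mul_factorial (by omega : p ≤ n + p + j),
        show n + p + j - p = n + j by omega]
    simp only [phiCoeff]
    rw [← e1, ← e2]
    push_cast
    ring
  rw [Finset.sum_congr rfl h1, ← Finset.sum_mul, ← Int.cast_sum, alternating_sum_choose]
  split_ifs with hk
  · obtain ⟨j, rfl⟩ := Nat.exists_eq_add_of_le hk
    have e1 := Nat.choose_mul_factorial_mul_factorial (by omega : j ≤ n + (k + j))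
    have e2 := Nat.factorial_mul_descFactorial hk
    rw [show n + (k + j) - j = n + k by omega] at e1
    rw [show k + j - k = j by omega] at e2 ⊢
    rw [← e1, ← e2]
    push_cast
    ring
  · rw [Nat.descFactorial_of_lt (not_le.mp hk)]
    simp

/-- Telescoping, since the dimension splits as 2k + n + 1 = (n + p + k + 1) - (p - k). At K = p + 1
the remainder is zero and the sum is 1. -/
theorem sum_descFactorial (n p K : ℕ) : ∑ k ∈ Finset.range K, (2 * k + n + 1 : ℂ) *
    ((p.descFactorial k * (n + p).factorial : ℂ) / ((n + p + k + 1).factorial : ℂ)) =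
    1 - (p.descFactorial K * (n + p).factorial : ℂ) / ((n + p + K).factorial : ℂ) := by
  induction K with
  | zero =>
    have : ((n + p).factorial : ℂ) ≠ 0 := by exact_mod_cast Nat.factorial_ne_zero _
    simp [this]
  | succ K ih =>
    rw [Finset.sum_range_succ, ih, Nat.descFactorial_succ, ← add_assoc, Nat.factorial_succ (n + p + K)]
    have h1 : ((n + p + K).factorial : ℂ) ≠ 0 := by exact_mod_cast Nat.factorial_ne_zero _
    have h2 : ((n : ℂ) + p + K + 1) ≠ 0 := by exact_mod_cast Nat.succ_ne_zero (n + p + K)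
    rcases le_or_gt K p with hK | hK
    · push_cast [hK]
      field_simp
      ring
    · rw [Nat.descFactorial_of_lt hK]
      simp

/-! ### Zonal inversion at the identity -/

/-- The zonal functions indexed by the weight `n : ℤ` and by `k`. -/
noncomputable def zonal (i : ℤ × ℕ) (g : SU2) : ℂ :=
  if 0 ≤ i.1 then phi i.1.natAbs i.2 g else conj (phi i.1.natAbs i.2 g)

/-- The dimension of the representation to which a zonal function belongs. -/
def weight (i : ℤ × ℕ) : ℕ := 2 * i.2 + i.1.natAbs + 1

theorem continuous_zonal (i : ℤ × ℕ) : Continuous (zonal i) := by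
  unfold zonal
  split_ifs
  · exact continuous_phi _ _
  · exact Complex.continuous_conj.comp (continuous_phi _ _)

theorem norm_zonal_le_one (i : ℤ × ℕ) (g : SU2) : ‖zonal i g‖ ≤ 1 := by
  unfold zonal
  split_ifs
  · exact norm_phi_le_one _ _ _
  · rw [RCLike.norm_conj]; exact norm_phi_le_one _ _ _

theorem conj_phi_zero (k : ℕ) (g : SU2) : conj (phi 0 k g) = phi 0 k g := by
  simp [phi_apply, conj_mon]

theorem conj_zonal (i : ℤ × ℕ) (g : SU2) : conj (zonal i g) = zonal (-i.1, i.2) g := by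
  obtain ⟨n, k⟩ := i
  simp only [zonal, Int.natAbs_neg]
  rcases lt_trichotomy n 0 with h | rfl | h
  · simp [h.not_ge, h.le]
  · simp [conj_phi_zero]
  · simp [h.le, h]

open MeasureTheory in
theorem integral_zonal_mul_mon {i : ℤ × ℕ} {p q r s : ℕ} (h : i.1 + p - q ≠ 0 ∨ r ≠ s) :
    ∫ g, zonal i g * mon p q r s g ∂haar = 0 := by
  have I := fun (c : ℂ) p q r s => (integrable_mon p q r s).const_mul c
  obtain ⟨n, k⟩ := i
  unfold zonal
  dsimp only at h ⊢
  split_ifs with hn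
  · simp only [phi_apply, Finset.sum_mul, mul_assoc, mon_mul]
    rw [integral_finsetSum _ fun s _ => I _ _ _ _ _]
    refine Finset.sum_eq_zero fun t ht => ?_
    have ht : t ≤ k := Nat.lt_succ_iff.mp (Finset.mem_range.mp ht)
    rw [integral_const_mul, integral_mon_eq_zero (by omega), mul_zero]
  · simp only [phi_apply, map_sum, map_mul, conj_mon, Finset.sum_mul, mul_assoc, mon_mul]
    rw [integral_finsetSum _ fun s _ => I _ _ _ _ _]
    refine Finset.sum_eq_zero fun t ht => ?_
    have ht : t ≤ k := Nat.lt_succ_iff.mp (Finset.mem_range.mp ht)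
    rw [integral_const_mul, integral_mon_eq_zero (by omega), mul_zero]

/-- The expansion of `F` in zonal functions at the identity converges to `F 1`. -/
def ZonalInversion (F : SU2 → ℂ) : Prop :=
  HasSum (fun i => (weight i : ℂ) * ∫ g, zonal i g * F g ∂haar) (F 1)

theorem ZonalInversion.conj {F : SU2 → ℂ} (hF : ZonalInversion F) :
    ZonalInversion fun g => conj (F g) := by
  have h := ((Equiv.neg ℤ).prodCongr (Equiv.refl ℕ)).hasSum_iff.mpr (Complex.hasSum_conj'.mpr hF)
  refine h.congr_fun fun i => ?_
  simp only [Function.comp, Equiv.prodCongr_apply, Prod.map, Equiv.neg_apply, Equiv.refl_apply,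
    map_mul, ← integral_conj, conj_zonal, weight, Int.natAbs_neg, neg_neg, map_natCast]

theorem zonalInversion_mon_base (n p : ℕ) : ZonalInversion (mon p (p + n) 0 0) := by
  have h : ∀ i ∉ ({(n : ℤ)} : Finset ℤ) ×ˢ Finset.range (p + 1),
      (weight i : ℂ) * ∫ g, zonal i g * mon p (p + n) 0 0 g ∂haar = 0 := by
    rintro ⟨m, k⟩ hi
    simp only [Finset.mem_product, Finset.mem_singleton, Finset.mem_range, not_and, not_lt] at hi
    by_cases hm : m = n
    · subst hm
      simp only [zonal, Int.natCast_nonneg, if_true, Int.natAbs_natCast]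
      rw [integral_phi_mul_mon, Nat.descFactorial_of_lt (by simpa using hi)]
      simp
    · rw [integral_zonal_mul_mon (by dsimp only; left; push_cast; omega), mul_zero]
  have hs := hasSum_sum_of_ne_finset_zero (L := .unconditional _) h
  unfold ZonalInversion
  convert hs using 1
  rw [Finset.sum_product, Finset.sum_singleton]
  have h2 := sum_descFactorial n p (p + 1)
  rw [Nat.descFactorial_of_lt (Nat.lt_succ_self p)] at h2
  simp only [Nat.cast_zero, zero_mul, zero_div, sub_zero] at h2
  rw [show mon p (p + n) 0 0 1 = 1 by simp [mon, α_one], ← h2]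
  refine Finset.sum_congr rfl fun k _ => ?_
  simp only [zonal, Int.natCast_nonneg, if_true, Int.natAbs_natCast, weight]
  rw [integral_phi_mul_mon]
  push_cast
  ring

/-- For r = s, replacing |β|² by 1 - |α|² reduces to monomials in `α` and its conjugate. For r ≠ s
every pairing vanishes, and so does the value at 1, where `β` is 0. -/
theorem zonalInversion_mon (p q r s : ℕ) : ZonalInversion (mon p q r s) := by
  by_cases hrs : r = s
  · subst hrs
    induction r generalizing p q with
    | zero =>
      rcases le_total p q with h | h
      · obtain ⟨n, rfl⟩ := Nat.exists_eq_add_of_le h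
        exact zonalInversion_mon_base n p
      · obtain ⟨n, rfl⟩ := Nat.exists_eq_add_of_le h
        have := (zonalInversion_mon_base n q).conj
        simp only [conj_mon] at this
        exact this
    | succ r ih =>
      have h := HasSum.sub (ih p q) (ih (p + 1) (q + 1))
      have e : ∀ g, mon p q (r + 1) (r + 1) g = mon p q r r g - mon (p + 1) (q + 1) r r g :=
        fun g => by rw [← mon_succ_add p q r r g]; ring
      unfold ZonalInversion
      simp only [e]
      refine h.congr_fun fun i => ?_
      have I : ∀ p q, MeasureTheory.Integrable (fun g => zonal i g * mon p q r r g) haar :=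
        fun p q => integrable_of_continuous ((continuous_zonal i).mul (continuous_mon p q r r))
      simp only [mul_sub]
      rw [MeasureTheory.integral_sub (I _ _) (I _ _)]
      ring
  · have h1 : mon p q r s 1 = 0 := by
      simp only [mon, β_one, map_zero]
      rcases r with _ | r
      · have : s ≠ 0 := fun h => hrs h.symm
        simp [this]
      · simp
    unfold ZonalInversion
    rw [h1]
    simp only [integral_zonal_mul_mon (Or.inr hrs), mul_zero]
    exact hasSum_zero

end SU2

/-! ### Polynomials, their eigenfunction decomposition and density -/

theorem mem_iSup_eigenspace_of_triangular {V : Type*} [AddCommGroup V] [Module ℝ V]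
    (T : Module.End ℝ V) {μ : ℕ → ℝ} (hμ : Function.Injective μ) (F : ℕ → V) (c : ℕ → ℝ)
    (h0 : T (F 0) = μ 0 • F 0) (h : ∀ i, T (F (i + 1)) = μ (i + 1) • F (i + 1) + c i • F i) (i : ℕ) :
    F i ∈ ⨆ j, ⨆ (_ : j ≤ i), Module.End.eigenspace T (μ j) := by
  induction i with
  | zero =>
    refine Submodule.mem_iSup_of_mem 0 (Submodule.mem_iSup_of_mem le_rfl ?_)
    exact Module.End.mem_eigenspace_iff.mpr h0
  | succ i ih =>
    set W := ⨆ j, ⨆ (_ : j ≤ i), Module.End.eigenspace T (μ j) with hW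
    -- As `μ (i + 1)` differs from the earlier eigenvalues, T - μ(i+1) maps `W` onto itself. A
    -- preimage of `F i` then corrects `F (i + 1)` into an eigenvector.
    have hle : W ≤ W.map (T - algebraMap ℝ (Module.End ℝ V) (μ (i + 1))) := by
      refine iSup₂_le fun j hj x hx => ?_
      have hne : μ j - μ (i + 1) ≠ 0 := sub_ne_zero.mpr fun he => by
        have := hμ he
        omega
      have hxW : x ∈ W := Submodule.mem_iSup_of_mem j (Submodule.mem_iSup_of_mem hj hx)
      refine ⟨(μ j - μ (i + 1))⁻¹ • x, W.smul_mem _ hxW, ?_⟩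
      rw [map_smul, LinearMap.sub_apply, Module.End.mem_eigenspace_iff.mp hx,
        Module.algebraMap_end_apply, ← sub_smul, inv_smul_smul₀ hne]
    obtain ⟨y, hy, hyF⟩ := hle ih
    rw [LinearMap.sub_apply, Module.algebraMap_end_apply] at hyF
    have hz : F (i + 1) - c i • y ∈ Module.End.eigenspace T (μ (i + 1)) := by
      rw [Module.End.mem_eigenspace_iff, map_sub, map_smul, h, ← hyF]
      module
    have hWle : W ≤ ⨆ j, ⨆ (_ : j ≤ i + 1), Module.End.eigenspace T (μ j) :=
      iSup₂_le fun j hj => le_iSup₂_of_le j (by omega) le_rfl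
    have := Submodule.add_mem _ (Submodule.mem_iSup_of_mem (p := fun j =>
      ⨆ (_ : j ≤ i + 1), Module.End.eigenspace T (μ j)) (i + 1)
      (Submodule.mem_iSup_of_mem le_rfl hz)) (hWle (W.smul_mem (c i) hy))
    rwa [sub_add_cancel] at this

namespace SU2

/-- Polynomials in the matrix entries and their conjugates, as complex valued functions. -/
noncomputable def complexPoly : Subalgebra ℂ (SU2 → ℂ) :=
  Algebra.adjoin ℂ {α, β, fun g => conj (α g), fun g => conj (β g)}

theorem α_mem : α ∈ complexPoly := Algebra.subset_adjoin (by simp)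

theorem β_mem : β ∈ complexPoly := Algebra.subset_adjoin (by simp)

theorem conj_α_mem : (fun g => conj (α g)) ∈ complexPoly := Algebra.subset_adjoin (by simp)

theorem conj_β_mem : (fun g => conj (β g)) ∈ complexPoly := Algebra.subset_adjoin (by simp)

theorem mon_mem (p q r s : ℕ) : mon p q r s ∈ complexPoly :=
  mul_mem (mul_mem (mul_mem (pow_mem α_mem p) (pow_mem conj_α_mem q)) (pow_mem β_mem r))
    (pow_mem conj_β_mem s)

theorem conj_mem {F : SU2 → ℂ} (hF : F ∈ complexPoly) : (fun g => conj (F g)) ∈ complexPoly := by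
  induction hF using Algebra.adjoin_induction with
  | mem F hF =>
    rcases hF with rfl | rfl | rfl | rfl
    · exact conj_α_mem
    · exact conj_β_mem
    · simpa using α_mem
    · simpa using β_mem
  | algebraMap c => exact complexPoly.algebraMap_mem (conj c)
  | add F G _ _ hF hG => simpa [Pi.add_def] using add_mem hF hG
  | mul F G _ _ hF hG => simpa [Pi.mul_def] using mul_mem hF hG

theorem comp_mul_left_mem {F : SU2 → ℂ} (hF : F ∈ complexPoly) (h : SU2) :
    (fun g => F (h * g)) ∈ complexPoly := by
  have hα : (fun g => α (h * g)) ∈ complexPoly := by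
    have := sub_mem (complexPoly.smul_mem α_mem (α h)) (complexPoly.smul_mem conj_β_mem (β h))
    simpa [α_mul, Pi.sub_def, Pi.smul_def] using this
  have hβ : (fun g => β (h * g)) ∈ complexPoly := by
    have := add_mem (complexPoly.smul_mem β_mem (α h)) (complexPoly.smul_mem conj_α_mem (β h))
    simpa [β_mul, Pi.add_def, Pi.smul_def] using this
  induction hF using Algebra.adjoin_induction with
  | mem F hF =>
    rcases hF with rfl | rfl | rfl | rfl
    · exact hα
    · exact hβ
    · exact conj_mem hα
    · exact conj_mem hβ
  | algebraMap c => exact complexPoly.algebraMap_mem c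
  | add F G _ _ hF hG => exact add_mem hF hG
  | mul F G _ _ hF hG => exact mul_mem hF hG

theorem complexPoly_le_span : Subalgebra.toSubmodule complexPoly ≤
    Submodule.span ℂ {F | ∃ p q r s, F = mon p q r s} := by
  rw [complexPoly, Algebra.adjoin_eq_span]
  refine Submodule.span_mono fun F hF => ?_
  induction hF using Submonoid.closure_induction with
  | mem F hF =>
    rcases hF with rfl | rfl | rfl | rfl
    · exact ⟨1, 0, 0, 0, by ext; simp [mon]⟩
    · exact ⟨0, 0, 1, 0, by ext; simp [mon]⟩
    · exact ⟨0, 1, 0, 0, by ext; simp [mon]⟩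
    · exact ⟨0, 0, 0, 1, by ext; simp [mon]⟩
  | one => exact ⟨0, 0, 0, 0, by ext; simp [mon]⟩
  | mul F G _ _ hF hG =>
    obtain ⟨p, q, r, s, rfl⟩ := hF
    obtain ⟨p', q', r', s', rfl⟩ := hG
    exact ⟨_, _, _, _, funext fun g => mon_mul p q r s p' q' r' s' g⟩

/-- `M` is only a real subspace; quantifying over all complex factors `c` lets the induction pass
through complex linear combinations. -/
theorem re_mem_of_mem_complexPoly {M : Submodule ℝ (SU2 → ℝ)}
    (hM : ∀ (c : ℂ) (p q r s : ℕ), (fun g => (c * mon p q r s g).re) ∈ M) {F : SU2 → ℂ}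
    (hF : F ∈ complexPoly) : (fun g => (F g).re) ∈ M := by
  suffices h : ∀ c : ℂ, (fun g => (c * F g).re) ∈ M by simpa using h 1
  have hF' := complexPoly_le_span hF
  clear hF
  induction hF' using Submodule.span_induction with
  | mem F hF => obtain ⟨p, q, r, s, rfl⟩ := hF; exact fun c => hM c p q r s
  | zero =>
    intro c
    have := M.zero_mem
    simpa [Pi.zero_def] using this
  | add F G _ _ hF hG =>
    intro c
    have := M.add_mem (hF c) (hG c)
    simpa [mul_add, Pi.add_def] using this
  | smul a F _ hF =>
    intro c
    simpa [mul_assoc] using hF (c * a)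

theorem continuous_of_mem {F : SU2 → ℂ} (hF : F ∈ complexPoly) : Continuous F := by
  induction hF using Algebra.adjoin_induction with
  | mem F hF =>
    rcases hF with rfl | rfl | rfl | rfl
    · exact continuous_α
    · exact continuous_β
    · exact Complex.continuous_conj.comp continuous_α
    · exact Complex.continuous_conj.comp continuous_β
  | algebraMap c => exact continuous_const
  | add F G _ _ hF hG => exact hF.add hG
  | mul F G _ _ hF hG => exact hF.mul hG

theorem zonalInversion_of_mem {F : SU2 → ℂ} (hF : F ∈ complexPoly) : ZonalInversion F := by
  suffices h : Continuous F ∧ ZonalInversion F from h.2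
  have hF' := complexPoly_le_span hF
  clear hF
  induction hF' using Submodule.span_induction with
  | mem F hF =>
    obtain ⟨p, q, r, s, rfl⟩ := hF
    exact ⟨continuous_mon _ _ _ _, zonalInversion_mon _ _ _ _⟩
  | zero => exact ⟨continuous_const, by simp [ZonalInversion, hasSum_zero]⟩
  | add F G _ _ hF hG =>
    refine ⟨hF.1.add hG.1, (HasSum.add hF.2 hG.2).congr_fun fun i => ?_⟩
    have IF : MeasureTheory.Integrable (fun g => zonal i g * F g) haar :=
      integrable_of_continuous ((continuous_zonal i).mul hF.1)
    have IG : MeasureTheory.Integrable (fun g => zonal i g * G g) haar :=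
      integrable_of_continuous ((continuous_zonal i).mul hG.1)
    simp only [Pi.add_apply, mul_add]
    rw [MeasureTheory.integral_add IF IG, mul_add]
  | smul a F _ hF =>
    refine ⟨hF.1.const_smul a, (HasSum.mul_left a hF.2).congr_fun fun i => ?_⟩
    simp only [Pi.smul_apply, smul_eq_mul, mul_left_comm _ a]
    rw [MeasureTheory.integral_const_mul, mul_left_comm]

/-- Real valued polynomials in the matrix entries and their conjugates. -/
noncomputable def poly : Subalgebra ℝ (SU2 → ℝ) :=
  (complexPoly.restrictScalars ℝ).comap (Complex.ofRealAm.compLeft SU2)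

theorem mem_poly_iff {f : SU2 → ℝ} : f ∈ poly ↔ (fun g => (f g : ℂ)) ∈ complexPoly := Iff.rfl

theorem re_mem_poly {F : SU2 → ℂ} (hF : F ∈ complexPoly) : (fun g => (F g).re) ∈ poly := by
  rw [mem_poly_iff]
  have := complexPoly.smul_mem (add_mem hF (conj_mem hF)) (1 / 2)
  convert this using 1
  ext g
  simp [Complex.add_conj]

theorem re_mon_mem_poly (c : ℂ) (p q r s : ℕ) : (fun g => (c * mon p q r s g).re) ∈ poly :=
  re_mem_poly (complexPoly.smul_mem (mon_mem p q r s) c)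

theorem poly_le {M : Submodule ℝ (SU2 → ℝ)}
    (hM : ∀ (c : ℂ) (p q r s : ℕ), (fun g => (c * mon p q r s g).re) ∈ M) {f : SU2 → ℝ}
    (hf : f ∈ poly) : f ∈ M := by
  simpa using re_mem_of_mem_complexPoly hM hf

theorem comp_mul_left_mem_poly {f : SU2 → ℝ} (hf : f ∈ poly) (h : SU2) :
    (fun g => f (h * g)) ∈ poly := comp_mul_left_mem (mem_poly_iff.mp hf) h

theorem re_lap_mem_poly (c : ℂ) (p q r s : ℕ) :
    sublaplacian (fun g => (c * mon p q r s g).re) ∈ poly := by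
  have h := ((hasLap_mon p q r s).smul c).re
  simp only [Pi.smul_apply, smul_eq_mul] at h
  rw [h]
  exact re_mem_poly (complexPoly.smul_mem (add_mem (complexPoly.smul_mem (mon_mem _ _ _ _) _)
    (add_mem (complexPoly.smul_mem (mon_mem _ _ _ _) _)
      (complexPoly.smul_mem (mon_mem _ _ _ _) _))) c)

theorem isSmooth_and_sublaplacian_mem {f : SU2 → ℝ} (hf : f ∈ poly) :
    IsSmooth f ∧ sublaplacian f ∈ poly := by
  let M : Submodule ℝ (SU2 → ℝ) :=
    { carrier := {f | IsSmooth f ∧ sublaplacian f ∈ poly}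
      add_mem' := fun {f g} hf hg => ⟨hf.1.add hg.1, by
        rw [hf.1.sublaplacian_add hg.1]; exact add_mem hf.2 hg.2⟩
      zero_mem' := by
        have h0 : sublaplacian (0 : SU2 → ℝ) = 0 := by
          simpa using sublaplacian_smul 0 (0 : SU2 → ℝ)
        exact ⟨IsSmooth.const 0, by rw [h0]; exact zero_mem poly⟩
      smul_mem' := fun c f hf => ⟨hf.1.smul c, by
        rw [sublaplacian_smul]; exact poly.smul_mem hf.2 c⟩ }
  exact poly_le (M := M) (fun c p q r s => ⟨isSmooth_re_mon c p q r s, re_lap_mem_poly c p q r s⟩) hf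

theorem isSmooth_of_mem {f : SU2 → ℝ} (hf : f ∈ poly) : IsSmooth f :=
  (isSmooth_and_sublaplacian_mem hf).1

/-- The sublaplacian as an endomorphism of the space of polynomials. -/
noncomputable def polyLap : Module.End ℝ poly where
  toFun f := ⟨sublaplacian f, (isSmooth_and_sublaplacian_mem f.2).2⟩
  map_add' f g := Subtype.ext ((isSmooth_of_mem f.2).sublaplacian_add (isSmooth_of_mem g.2))
  map_smul' c f := Subtype.ext (sublaplacian_smul c f.1)

/-- Without powers of β̄ only the term in |β|² leaves the diagonal, and |β|² = 1 - |α|² makes it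
lower p and q together: the action becomes triangular. -/
theorem polyLap_re_mon (c : ℂ) (p q r : ℕ) :
    polyLap ⟨_, re_mon_mem_poly c p q r 0⟩ =
      (-(4 * p * r + 4 * p * q + 2 * (p + q + r)) : ℝ) • ⟨_, re_mon_mem_poly c p q r 0⟩ +
        (4 * p * q : ℝ) • (⟨_, re_mon_mem_poly c (p - 1) (q - 1) r 0⟩ : poly) := by
  apply Subtype.ext
  have h := ((hasLap_mon p q r 0).smul c).re
  simp only [Pi.smul_apply, smul_eq_mul] at h
  refine h.trans ?_
  ext g
  have e : (p * q : ℂ) * mon (p - 1) (q - 1) (r + 1) (0 + 1) g =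
      (p * q : ℂ) * mon (p - 1) (q - 1) r 0 g - (p * q : ℂ) * mon p q r 0 g := by
    rcases p with _ | p
    · simp
    rcases q with _ | q
    · simp
    rw [← mul_sub, ← mon_succ_add (p + 1 - 1) (q + 1 - 1) r 0 g]
    simp
  have e2 : c * (((-2 * (r * (p + 1) + q * ((0 : ℕ) + 1) + p * (r + 1) + (0 : ℕ) * (q + 1)) : ℂ) •
      mon p q r 0 + ((4 * r * (0 : ℕ) : ℂ) • mon (p + 1) (q + 1) (r - 1) (0 - 1) +
      (4 * p * q : ℂ) • mon (p - 1) (q - 1) (r + 1) (0 + 1))) g) =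
      ((-(4 * p * r + 4 * p * q + 2 * (p + q + r)) : ℝ) : ℂ) * (c * mon p q r 0 g) +
        ((4 * p * q : ℝ) : ℂ) * (c * mon (p - 1) (q - 1) r 0 g) := by
    simp only [Pi.add_apply, Pi.smul_apply, smul_eq_mul]
    push_cast
    linear_combination 4 * c * e
  rw [e2, Complex.add_re, Complex.re_ofReal_mul, Complex.re_ofReal_mul]
  rfl

theorem re_mon_mem_iSup (c : ℂ) (p q r s : ℕ) :
    (⟨_, re_mon_mem_poly c p q r s⟩ : poly) ∈ ⨆ μ, Module.End.eigenspace polyLap μ := by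
  -- Each chain starts where p or q is zero, so its first element is already an eigenfunction; the
  -- diagonal entries strictly decrease along the chain.
  have base : ∀ (c : ℂ) (p q i r : ℕ), p = 0 ∨ q = 0 →
      (⟨_, re_mon_mem_poly c (p + i) (q + i) r 0⟩ : poly) ∈
        ⨆ μ, Module.End.eigenspace polyLap μ := by
    intro c p q i r hpq
    set μ : ℕ → ℝ := fun i => -(4 * (p + i : ℕ) * r + 4 * (p + i : ℕ) * (q + i : ℕ) +
      2 * ((p + i : ℕ) + (q + i : ℕ) + r)) with hμ
    have hanti : StrictAnti μ := strictAnti_nat_of_succ_lt fun i => by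
      simp only [hμ]
      push_cast
      have : (0 : ℝ) ≤ r := r.cast_nonneg
      have : (0 : ℝ) ≤ p := p.cast_nonneg
      have : (0 : ℝ) ≤ q := q.cast_nonneg
      have : (0 : ℝ) ≤ i := i.cast_nonneg
      nlinarith
    have := mem_iSup_eigenspace_of_triangular polyLap hanti.injective
      (fun i => ⟨_, re_mon_mem_poly c (p + i) (q + i) r 0⟩)
      (fun i => 4 * (p + (i + 1) : ℕ) * (q + (i + 1) : ℕ)) ?_ ?_ i
    · refine (iSup₂_le fun j _ => ?_ : (⨆ j, ⨆ (_ : j ≤ i), Module.End.eigenspace polyLap (μ j)) ≤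
        ⨆ μ, Module.End.eigenspace polyLap μ) this
      exact le_iSup (fun μ => Module.End.eigenspace polyLap μ) (μ j)
    · refine (polyLap_re_mon c (p + 0) (q + 0) r).trans ?_
      have : (4 * (p + 0 : ℕ) * (q + 0 : ℕ) : ℝ) = 0 := by
        rcases hpq with rfl | rfl <;> simp
      rw [this, zero_smul, add_zero]
      congr 1
      simp only [hμ, this]
    · intro i
      exact polyLap_re_mon c (p + (i + 1)) (q + (i + 1)) r
  have main : ∀ (c : ℂ) (p q r : ℕ), (⟨_, re_mon_mem_poly c p q r 0⟩ : poly) ∈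
      ⨆ μ, Module.End.eigenspace polyLap μ := by
    intro c p q r
    rcases le_total p q with h | h
    · obtain ⟨n, rfl⟩ := Nat.exists_eq_add_of_le' h
      simpa using base c 0 n p r (Or.inl rfl)
    · obtain ⟨n, rfl⟩ := Nat.exists_eq_add_of_le' h
      simpa using base c n 0 q r (Or.inr rfl)
  induction r generalizing p q s with
  | zero =>
    have e : (⟨_, re_mon_mem_poly c p q 0 s⟩ : poly) = ⟨_, re_mon_mem_poly (conj c) q p s 0⟩ := by
      apply Subtype.ext
      ext g
      dsimp only
      rw [← Complex.conj_re, map_mul, conj_mon]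
    rw [e]
    exact main _ _ _ _
  | succ r ih =>
    cases s with
    | zero => exact main _ _ _ _
    | succ s =>
      have e : (⟨_, re_mon_mem_poly c p q (r + 1) (s + 1)⟩ : poly) =
          ⟨_, re_mon_mem_poly c p q r s⟩ - ⟨_, re_mon_mem_poly c (p + 1) (q + 1) r s⟩ := by
        apply Subtype.ext
        ext g
        change _ = (c * mon p q r s g).re - (c * mon (p + 1) (q + 1) r s g).re
        rw [← mon_succ_add p q r s g, mul_add, Complex.add_re]
        ring
      rw [e]
      exact Submodule.sub_mem _ (ih _ _ _) (ih _ _ _)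

/-- Every polynomial is a finite sum of polynomial eigenfunctions of the sublaplacian. -/
theorem exists_eigenfunction_decomposition {f : SU2 → ℝ} (hf : f ∈ poly) :
    ∃ (t : Finset ℝ) (e : ℝ → SU2 → ℝ),
      (∀ μ, e μ ∈ poly ∧ sublaplacian (e μ) = μ • e μ) ∧ f = ∑ μ ∈ t, e μ := by
  have h1 : (⟨f, hf⟩ : poly) ∈ ⨆ μ, Module.End.eigenspace polyLap μ := by
    have h2 : f ∈ (⨆ μ, Module.End.eigenspace polyLap μ).map (Subalgebra.toSubmodule poly).subtype :=
      poly_le (fun c p q r s => Submodule.mem_map_of_mem (re_mon_mem_iSup c p q r s)) hf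
    obtain ⟨y, hy, hyf⟩ := h2
    have : y = ⟨f, hf⟩ := Subtype.ext hyf
    exact this ▸ hy
  obtain ⟨e, he, hsum⟩ := (Submodule.mem_iSup_iff_exists_finsupp _ _).mp h1
  refine ⟨e.support, fun μ => e μ, fun μ => ⟨(e μ).2, ?_⟩, ?_⟩
  · exact congrArg Subtype.val (Module.End.mem_eigenspace_iff.mp (he μ))
  · have := congrArg Subtype.val hsum
    refine this.symm.trans ?_
    rw [Finsupp.sum]
    simp

/-- Stone–Weierstrass; points are separated because `α` and `β` determine the group element. -/
theorem dense_poly : Dense {f : C(SU2, ℝ) | ⇑f ∈ poly} := by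
  let A : Subalgebra ℝ C(SU2, ℝ) := poly.comap (ContinuousMap.coeFnAlgHom ℝ)
  have hA : A.SeparatesPoints := by
    intro g h hgh
    by_contra! hcon
    have key : ∀ F ∈ complexPoly, F g = F h := by
      intro F hF
      have h1 : ∀ c : ℂ, (c * F g).re = (c * F h).re := by
        intro c
        have hm := re_mem_poly (complexPoly.smul_mem hF c)
        exact hcon _ ⟨⟨_, (isSmooth_of_mem hm).continuous⟩, hm, rfl⟩
      apply Complex.ext
      · simpa using h1 1
      · simpa using h1 (-Complex.I)
    exact hgh (ext_αβ (key _ α_mem) (key _ β_mem))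
  have := ContinuousMap.subalgebra_topologicalClosure_eq_top_of_separatesPoints A hA
  intro f
  have hf : f ∈ A.topologicalClosure := this ▸ Algebra.mem_top
  exact hf

/-! ### The kernel series -/

/-- The eigenvalue of minus the sublaplacian on the zonal function of index `i`. -/
noncomputable def freq (i : ℤ × ℕ) : ℝ := eigenvalue i.1.natAbs i.2

theorem freq_nonneg (i : ℤ × ℕ) : 0 ≤ freq i := by
  unfold freq eigenvalue; positivity

theorem natAbs_add_le_freq (i : ℤ × ℕ) : 2 * ((i.1.natAbs : ℝ) + i.2) ≤ freq i := by
  unfold freq eigenvalue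
  have : (0 : ℝ) ≤ i.2 := i.2.cast_nonneg
  have : (0 : ℝ) ≤ i.1.natAbs := i.1.natAbs.cast_nonneg
  nlinarith [mul_nonneg (a := (i.2 : ℝ)) (b := (i.2 : ℝ) + i.1.natAbs) (by positivity) (by positivity)]

theorem weight_le (i : ℤ × ℕ) : (weight i : ℝ) ≤ 1 + freq i := by
  have := natAbs_add_le_freq i
  have : (0 : ℝ) ≤ i.1.natAbs := i.1.natAbs.cast_nonneg
  simp only [weight]
  push_cast
  linarith

theorem summable_exp_neg_freq {t : ℝ} (ht : 0 < t) :
    Summable fun i : ℤ × ℕ => Real.exp (-freq i * t) := by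
  have hq0 : 0 ≤ Real.exp (-t) := (Real.exp_pos _).le
  have hq1 : Real.exp (-t) < 1 := by simpa using ht
  have h1 : Summable fun k : ℕ => Real.exp (-t) ^ k := summable_geometric_of_lt_one hq0 hq1
  have h2 : Summable fun n : ℤ => Real.exp (-t) ^ n.natAbs :=
    Summable.of_nat_of_neg (by simpa using h1) (by simpa using h1)
  refine Summable.of_nonneg_of_le (fun i => (Real.exp_pos _).le) (fun i => ?_)
    (h2.mul_of_nonneg h1 (fun n => by positivity) (fun k => by positivity))
  rw [← pow_add, ← Real.exp_nat_mul]
  apply Real.exp_le_exp.mpr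
  have := natAbs_add_le_freq i
  have : (0 : ℝ) ≤ i.2 := i.2.cast_nonneg
  have : (0 : ℝ) ≤ i.1.natAbs := i.1.natAbs.cast_nonneg
  push_cast
  nlinarith

theorem summable_weight_mul {t : ℝ} (ht : 0 < t) :
    Summable fun i : ℤ × ℕ => weight i * (1 + freq i) * Real.exp (-freq i * t) := by
  refine Summable.of_nonneg_of_le (fun i => ?_) (fun i => ?_)
    ((summable_exp_neg_freq (half_pos ht)).mul_left ((4 / t) ^ 2 * Real.exp (t / 2)))
  · have := freq_nonneg i; positivity
  · have h0 := freq_nonneg i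
    have hw := weight_le i
    set x := freq i
    have h1 : (1 + x) * t / 4 ≤ Real.exp ((1 + x) * t / 4) := by
      linarith [Real.add_one_le_exp ((1 + x) * t / 4)]
    -- Squared, this absorbs the polynomial factor (1 + x)² into e^{(1+x)t/2}, at the cost of half
    -- of the decay e^{-xt}.
    have h2 : 1 + x ≤ 4 / t * Real.exp ((1 + x) * t / 4) := by
      rw [div_mul_eq_mul_div, le_div_iff₀ ht]; linarith
    have h3 : (1 + x) ^ 2 ≤ (4 / t) ^ 2 * Real.exp ((1 + x) * t / 2) := by
      calc (1 + x) ^ 2 ≤ (4 / t * Real.exp ((1 + x) * t / 4)) ^ 2 := by gcongr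
        _ = _ := by rw [mul_pow, ← Real.exp_nat_mul]; congr 2; push_cast; ring
    calc weight i * (1 + x) * Real.exp (-x * t) ≤ (1 + x) ^ 2 * Real.exp (-x * t) := by
          rw [sq]; gcongr
      _ ≤ ((4 / t) ^ 2 * Real.exp ((1 + x) * t / 2)) * Real.exp (-x * t) := by gcongr
      _ = (4 / t) ^ 2 * Real.exp (t / 2) * Real.exp (-x * (t / 2)) := by
          rw [mul_assoc, mul_assoc, ← Real.exp_add, ← Real.exp_add]; congr 2; ring

theorem summable_weight_mul_exp {t : ℝ} (ht : 0 < t) :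
    Summable fun i : ℤ × ℕ => weight i * Real.exp (-freq i * t) := by
  refine Summable.of_nonneg_of_le (fun i => by positivity) (fun i => ?_) (summable_weight_mul ht)
  have := freq_nonneg i
  gcongr
  exact le_mul_of_one_le_right (by positivity) (by linarith)

/-- The real part of a zonal function. -/
noncomputable def reZonal (i : ℤ × ℕ) (g : SU2) : ℝ := (phi i.1.natAbs i.2 g).re

theorem reZonal_eq (i : ℤ × ℕ) (g : SU2) : reZonal i g = (zonal i g).re := by
  unfold reZonal zonal
  split_ifs <;> simp

theorem reZonal_mem_poly (i : ℤ × ℕ) : reZonal i ∈ poly :=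
  re_mem_poly (sum_mem fun _ _ => complexPoly.smul_mem (mon_mem _ _ _ _) _)

theorem continuous_reZonal (i : ℤ × ℕ) : Continuous (reZonal i) :=
  (isSmooth_of_mem (reZonal_mem_poly i)).continuous

theorem abs_reZonal_le (i : ℤ × ℕ) (g : SU2) : |reZonal i g| ≤ 1 :=
  (Complex.abs_re_le_norm _).trans (norm_phi_le_one _ _ _)

theorem sublaplacian_reZonal (i : ℤ × ℕ) : sublaplacian (reZonal i) = -freq i • reZonal i := by
  have := (hasLap_phi i.1.natAbs i.2).re
  refine this.trans ?_
  ext g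
  simp [freq, reZonal]

/-- The coefficient of `f` along a real zonal function. -/
noncomputable def coeff (i : ℤ × ℕ) (f : SU2 → ℝ) : ℝ := ∫ g, reZonal i g * f g ∂haar

theorem coeff_sublaplacian {f : SU2 → ℝ} (hf : IsSmooth f) (i : ℤ × ℕ) :
    coeff i (sublaplacian f) = -freq i * coeff i f := by
  unfold coeff
  rw [← (isSmooth_of_mem (reZonal_mem_poly i)).integral_sublaplacian_mul hf,
    sublaplacian_reZonal, ← MeasureTheory.integral_const_mul]
  simp [mul_assoc]

theorem abs_coeff_le {f : SU2 → ℝ} {C : ℝ} (hC : ∀ g, |f g| ≤ C) (i : ℤ × ℕ) :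
    |coeff i f| ≤ C := by
  have := MeasureTheory.norm_integral_le_of_norm_le_const (μ := haar) (C := C)
    (f := fun g => reZonal i g * f g) (Filter.Eventually.of_forall fun g => by
      rw [norm_mul, Real.norm_eq_abs, Real.norm_eq_abs]
      calc _ ≤ 1 * C := mul_le_mul (abs_reZonal_le i g) (hC g) (abs_nonneg _) zero_le_one
        _ = C := one_mul C)
  simpa [coeff] using this

theorem hasSum_coeff {f : SU2 → ℝ} (hf : f ∈ poly) :
    HasSum (fun i => weight i * coeff i f) (f 1) := by
  have h := Complex.hasSum_re (zonalInversion_of_mem (mem_poly_iff.mp hf))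
  refine h.congr_fun fun i => ?_
  have hint : MeasureTheory.Integrable (fun g => zonal i g * (f g : ℂ)) haar :=
    integrable_of_continuous ((continuous_zonal i).mul (continuous_of_mem hf))
  have h2 : ∫ g, (zonal i g * (f g : ℂ)).re ∂haar = (∫ g, zonal i g * (f g : ℂ) ∂haar).re :=
    integral_re hint
  rw [← Complex.ofReal_natCast, Complex.re_ofReal_mul, ← h2, coeff]
  simp [reZonal_eq]

/-- The subelliptic heat kernel issued from the identity. -/
noncomputable def kernel (t : ℝ) (g : SU2) : ℝ :=
  ∑' i, weight i * Real.exp (-freq i * t) * reZonal i g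

theorem norm_kernel_term_le (t : ℝ) (i : ℤ × ℕ) (g : SU2) :
    ‖weight i * Real.exp (-freq i * t) * reZonal i g‖ ≤ weight i * Real.exp (-freq i * t) := by
  rw [norm_mul, Real.norm_of_nonneg (by positivity), Real.norm_eq_abs]
  exact mul_le_of_le_one_right (by positivity) (abs_reZonal_le i g)

theorem continuous_kernel {t : ℝ} (ht : 0 < t) : Continuous (kernel t) :=
  continuous_tsum (fun i => (continuous_reZonal i).const_mul _) (summable_weight_mul_exp ht)
    fun i g => norm_kernel_term_le t i g

theorem hasSum_integral_kernel {t : ℝ} (ht : 0 < t) {f : SU2 → ℝ} (hf : Continuous f) :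
    HasSum (fun i => weight i * Real.exp (-freq i * t) * coeff i f)
      (∫ g, kernel t g * f g ∂haar) := by
  obtain ⟨C, hC⟩ := exists_norm_le hf
  have hC0 : 0 ≤ C := (norm_nonneg _).trans (hC 1)
  have hcont : ∀ i, Continuous fun g =>
      weight i * Real.exp (-freq i * t) * reZonal i g * f g := fun i =>
    ((continuous_reZonal i).const_mul _).mul hf
  have h := MeasureTheory.hasSum_integral_of_summable_integral_norm (μ := haar)
    (F := fun i g => weight i * Real.exp (-freq i * t) * reZonal i g * f g)
    (fun i => integrable_of_continuous (hcont i)) ?_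
  · have e : ∀ g, ∑' i, weight i * Real.exp (-freq i * t) * reZonal i g * f g =
        kernel t g * f g := fun g => tsum_mul_right
    simp only [e] at h
    refine h.congr_fun fun i => ?_
    rw [coeff, ← MeasureTheory.integral_const_mul]
    simp only [mul_assoc]
  · refine Summable.of_nonneg_of_le (fun i => MeasureTheory.integral_nonneg fun g => norm_nonneg _)
      (fun i => ?_) ((summable_weight_mul_exp ht).mul_right C)
    calc _ ≤ ∫ _, weight i * Real.exp (-freq i * t) * C ∂haar := by
          refine MeasureTheory.integral_mono (integrable_of_continuous (hcont i).norm)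
            (MeasureTheory.integrable_const _) fun g => ?_
          dsimp only
          rw [norm_mul]
          exact mul_le_mul (norm_kernel_term_le t i g) (hC g) (norm_nonneg _) (by positivity)
      _ = _ := by simp

/-- By symmetry of the sublaplacian a coefficient of `f` vanishes unless -`freq i` = μ. Every
exponential may thus be replaced by e^{μt}, and zonal inversion sums the rest to f(1). -/
theorem integral_kernel_eigenfunction {t : ℝ} (ht : 0 < t) {f : SU2 → ℝ} (hf : f ∈ poly) {μ : ℝ}
    (hμ : sublaplacian f = μ • f) : ∫ g, kernel t g * f g ∂haar = Real.exp (μ * t) * f 1 := by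
  have hs := isSmooth_of_mem hf
  refine (hasSum_integral_kernel ht hs.continuous).unique ?_
  refine ((hasSum_coeff hf).mul_left (Real.exp (μ * t))).congr_fun fun i => ?_
  have h := coeff_sublaplacian hs i
  have h2 : coeff i (sublaplacian f) = μ * coeff i f := by
    rw [hμ, coeff, coeff, ← MeasureTheory.integral_const_mul]
    simp only [Pi.smul_apply, smul_eq_mul, mul_left_comm]
  have h3 : (μ + freq i) * coeff i f = 0 := by linear_combination h - h2
  rcases mul_eq_zero.mp h3 with h4 | h4
  · rw [eq_neg_of_add_eq_zero_left h4]; ring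
  · rw [h4]; ring

theorem hasDerivAt_integral_kernel {t : ℝ} (ht : 0 < t) {f : SU2 → ℝ} (hf : IsSmooth f) :
    HasDerivAt (fun s => ∫ g, kernel s g * f g ∂haar)
      (∫ g, kernel t g * sublaplacian f g ∂haar) t := by
  obtain ⟨C, hC⟩ := exists_norm_le hf.continuous
  have hC0 : 0 ≤ C := (norm_nonneg _).trans (hC 1)
  -- Termwise differentiation is carried out on (t/2, ∞), where the differentiated series has the
  -- summable majorant taken at time t/2.
  have hmem : t ∈ Set.Ioi (t / 2) := half_lt_self ht
  have hd := hasDerivAt_tsum_of_isPreconnected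
    (g := fun i s => weight i * Real.exp (-freq i * s) * coeff i f)
    (g' := fun i s => weight i * Real.exp (-freq i * s) * coeff i (sublaplacian f))
    ((summable_weight_mul (half_pos ht)).mul_right C) (isOpen_Ioi (a := t / 2)) isPreconnected_Ioi
    (fun i s _ => ?_) (fun i s hs => ?_) hmem (hasSum_integral_kernel ht hf.continuous).summable hmem
  · rw [(hasSum_integral_kernel ht hf.sublaplacian.continuous).tsum_eq] at hd
    refine hd.congr_of_eventuallyEq ?_
    filter_upwards [lt_mem_nhds ht] with s hs
    exact (hasSum_integral_kernel hs hf.continuous).tsum_eq.symm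
  · rw [coeff_sublaplacian hf]
    have h1 := ((((hasDerivAt_id s).const_mul (-freq i)).exp).const_mul (weight i : ℝ)).mul_const
      (coeff i f)
    refine h1.congr_deriv ?_
    simp only [id]
    ring
  · rw [coeff_sublaplacian hf, norm_mul, norm_mul, norm_mul, norm_neg,
      Real.norm_of_nonneg (freq_nonneg i), Real.norm_of_nonneg (Nat.cast_nonneg _),
      Real.norm_of_nonneg (Real.exp_nonneg _)]
    have h1 : Real.exp (-freq i * s) ≤ Real.exp (-freq i * (t / 2)) := by
      apply Real.exp_le_exp.mpr
      nlinarith [freq_nonneg i, Set.mem_Ioi.mp hs]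
    have h2 : ‖coeff i f‖ ≤ C := abs_coeff_le hC i
    have h3 := freq_nonneg i
    calc _ ≤ weight i * Real.exp (-freq i * (t / 2)) * ((1 + freq i) * C) := by
          gcongr
          linarith
      _ = _ := by ring

/-! ### Existence of the heat semigroup -/

instance : FirstCountableTopology SU2 :=
  have : FirstCountableTopology (Matrix (Fin 2) (Fin 2) ℂ) :=
    inferInstanceAs (FirstCountableTopology (Fin 2 → Fin 2 → ℂ))
  Topology.IsInducing.subtypeVal.firstCountableTopology

/-- The operator `f ↦ ∫ p(h) f(· h) dh`. -/
noncomputable def convOp (p : C(SU2, ℝ)) : C(SU2, ℝ) →L[ℝ] C(SU2, ℝ) :=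
  LinearMap.mkContinuous
    { toFun := fun f => ⟨fun g => ∫ h, p h * f (g * h) ∂haar, by
        have : Continuous (Function.uncurry fun g h : SU2 => p h * f (g * h)) := by fun_prop
        simpa using continuous_parametric_integral_of_continuous this isCompact_univ (μ := haar)⟩
      map_add' := fun f₁ f₂ => by
        ext g
        have I : ∀ f : C(SU2, ℝ), MeasureTheory.Integrable (fun h => p h * f (g * h)) haar :=
          fun f => integrable_of_continuous (by fun_prop)
        simp only [ContinuousMap.coe_mk, ContinuousMap.add_apply, mul_add]
        exact MeasureTheory.integral_add (I f₁) (I f₂)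
      map_smul' := fun c f => by
        ext g
        simp only [ContinuousMap.coe_mk, ContinuousMap.smul_apply, smul_eq_mul, RingHom.id_apply,
          mul_left_comm _ c]
        exact MeasureTheory.integral_const_mul _ _ }
    ‖p‖ fun f => by
      refine (ContinuousMap.norm_le _ (by positivity)).mpr fun g => ?_
      have := MeasureTheory.norm_integral_le_of_norm_le_const (μ := haar) (C := ‖p‖ * ‖f‖)
        (f := fun h => p h * f (g * h)) (Filter.Eventually.of_forall fun h => by
          rw [norm_mul]
          exact mul_le_mul (p.norm_coe_le_norm h) (f.norm_coe_le_norm _) (norm_nonneg _)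
            (norm_nonneg _))
      simpa using this

theorem convOp_apply (p f : C(SU2, ℝ)) (g : SU2) :
    convOp p f g = ∫ h, p h * f (g * h) ∂haar := rfl

open Classical in
/-- The subelliptic heat semigroup. -/
noncomputable def heat (t : ℝ≥0) : C(SU2, ℝ) →L[ℝ] C(SU2, ℝ) :=
  if ht : 0 < t then convOp ⟨kernel t, continuous_kernel (NNReal.coe_pos.mpr ht)⟩ else
    ContinuousLinearMap.id ℝ _

theorem heat_zero : heat 0 = ContinuousLinearMap.id ℝ _ := by simp [heat]

theorem heat_apply {t : ℝ≥0} (ht : 0 < t) (f : C(SU2, ℝ)) (g : SU2) :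
    heat t f g = ∫ h, kernel t h * f (g * h) ∂haar := by
  rw [heat, dif_pos ht, convOp_apply]; rfl

theorem heat_eigenfunction (t : ℝ≥0) {f : C(SU2, ℝ)} (hf : ⇑f ∈ poly) {μ : ℝ}
    (hμ : sublaplacian f = μ • ⇑f) : heat t f = Real.exp (μ * t) • f := by
  rcases eq_or_lt_of_le (zero_le (a := t)) with rfl | ht
  · simp [heat_zero]
  · ext g
    rw [heat_apply ht, integral_kernel_eigenfunction (f := fun h => f (g * h))
      (NNReal.coe_pos.mpr ht) (comp_mul_left_mem_poly hf g) (μ := μ)]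
    · simp
    · rw [sublaplacian_comp_mul_left, hμ]; rfl

theorem exists_eigenfunction_decomposition' {f : C(SU2, ℝ)} (hf : ⇑f ∈ poly) :
    ∃ (t : Finset ℝ) (e : ℝ → C(SU2, ℝ)),
      (∀ μ, ⇑(e μ) ∈ poly ∧ sublaplacian (e μ) = μ • ⇑(e μ)) ∧ f = ∑ μ ∈ t, e μ := by
  obtain ⟨t, e, he, hsum⟩ := exists_eigenfunction_decomposition hf
  refine ⟨t, fun μ => ⟨e μ, (isSmooth_of_mem (he μ).1).continuous⟩, he, ?_⟩
  ext g
  rw [hsum]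
  simp

theorem sublaplacian_sum (t : Finset ℝ) (c : ℝ → ℝ) (e : ℝ → SU2 → ℝ)
    (he : ∀ μ, e μ ∈ poly ∧ sublaplacian (e μ) = μ • e μ) :
    sublaplacian (∑ μ ∈ t, c μ • e μ) = ∑ μ ∈ t, (μ * c μ) • e μ := by
  induction t using Finset.induction_on with
  | empty => simpa using sublaplacian_smul 0 (0 : SU2 → ℝ)
  | insert a t ha ih =>
    have hs : ∀ μ, c μ • e μ ∈ poly := fun μ => poly.smul_mem (he μ).1 _
    rw [Finset.sum_insert ha, Finset.sum_insert ha, (isSmooth_of_mem (hs a)).sublaplacian_add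
      (isSmooth_of_mem (sum_mem fun μ _ => hs μ)), ih, sublaplacian_smul, (he a).2, smul_smul,
      mul_comm]

/-- The parabolic maximum principle. -/
theorem sum_exp_mul_le (t : Finset ℝ) (e : ℝ → SU2 → ℝ)
    (he : ∀ μ, e μ ∈ poly ∧ sublaplacian (e μ) = μ • e μ) {M : ℝ}
    (hM : ∀ g, ∑ μ ∈ t, e μ g ≤ M) {T : ℝ} (hT : 0 ≤ T) (g : SU2) :
    ∑ μ ∈ t, Real.exp (μ * T) * e μ g ≤ M := by
  suffices h : ∀ ε > 0, ∑ μ ∈ t, Real.exp (μ * T) * e μ g ≤ M + ε * T by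
    refine le_of_forall_pos_le_add fun δ hδ => ?_
    refine (h (δ / (T + 1)) (by positivity)).trans ?_
    have : δ / (T + 1) * T ≤ δ := by
      rw [div_mul_eq_mul_div, div_le_iff₀ (by positivity)]
      nlinarith
    linarith
  intro ε hε
  -- The term -εs makes the inequality strict: at a maximum with s > 0 the spatial maximum principle
  -- gives ∂v/∂s ≤ -ε, while maximality in time gives ∂v/∂s ≥ 0.
  set v : ℝ × SU2 → ℝ := fun x => ∑ μ ∈ t, Real.exp (μ * x.1) * e μ x.2 - ε * x.1 with hv
  have hcont : Continuous v := by
    have := fun μ => (isSmooth_of_mem (he μ).1).continuous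
    fun_prop
  obtain ⟨⟨s, g₀⟩, ⟨hs, -⟩, hmax⟩ := (isCompact_Icc (a := (0 : ℝ)) (b := T)).prod
    (isCompact_univ (X := SU2)) |>.exists_isMaxOn ⟨(0, g), ⟨⟨le_rfl, hT⟩, trivial⟩⟩ hcont.continuousOn
  have hs : s ∈ Set.Icc 0 T := hs
  have hle : ∀ r ∈ Set.Icc 0 T, ∀ h, v (r, h) ≤ v (s, g₀) := fun r hr h => hmax ⟨hr, trivial⟩
  have hfinal := hle T ⟨hT, le_rfl⟩ g
  rcases eq_or_lt_of_le hs.1 with rfl | hpos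
  · have := hM g₀
    simp only [hv, mul_zero, Real.exp_zero, one_mul, sub_zero] at hfinal
    linarith
  · exfalso
    have hd : HasDerivAt (fun r => v (r, g₀))
        (∑ μ ∈ t, (μ * Real.exp (μ * s)) * e μ g₀ - ε) s := by
      have h1 : ∀ μ ∈ t, HasDerivAt (fun r => Real.exp (μ * r) * e μ g₀)
          ((μ * Real.exp (μ * s)) * e μ g₀) s := fun μ _ => by
        have := (((hasDerivAt_id s).const_mul μ).exp).mul_const (e μ g₀)
        refine this.congr_deriv ?_
        simp only [id]
        ring
      have h2 := (HasDerivAt.fun_sum h1).sub ((hasDerivAt_id s).const_mul ε)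
      refine h2.congr_deriv (by simp)
    have hnonpos := ((isSmooth_of_mem (sum_mem fun μ _ => poly.smul_mem (he μ).1 _) :
      IsSmooth (∑ μ ∈ t, Real.exp (μ * s) • e μ))).sublaplacian_nonpos (g := g₀) fun h => by
        have := hle s hs h
        simp only [hv] at this
        simpa using this
    rw [sublaplacian_sum t _ e he] at hnonpos
    simp only [Finset.sum_apply, Pi.smul_apply, smul_eq_mul] at hnonpos
    have hlm : IsLocalMaxOn (fun r => v (r, g₀)) (Set.Icc 0 T) s :=
      Filter.eventually_of_mem self_mem_nhdsWithin fun r hr => hle r hr g₀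
    -- The maximum may sit at the endpoint s = T, so only the backward direction in time is used.
    have htan : (0 - s) ∈ posTangentConeAt (Set.Icc 0 T) s :=
      sub_mem_posTangentConeAt_of_segment_subset ((convex_Icc 0 T).segment_subset hs ⟨le_rfl, hT⟩)
    have := hlm.hasFDerivWithinAt_nonpos hd.hasFDerivAt.hasFDerivWithinAt htan
    simp at this
    nlinarith

/-- On polynomials this is the parabolic maximum principle applied to f and -f, so positivity of the
kernel is never needed. The bound supplies the uniformity behind strong continuity. -/
theorem norm_heat_le (t : ℝ≥0) (f : C(SU2, ℝ)) : ‖heat t f‖ ≤ ‖f‖ := by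
  have hclosed : IsClosed {f : C(SU2, ℝ) | ‖heat t f‖ ≤ ‖f‖} :=
    isClosed_le (by fun_prop) continuous_norm
  refine (hclosed.closure_subset_iff (s := {f : C(SU2, ℝ) | ⇑f ∈ poly})).mpr ?_ (dense_poly f)
  intro f hf
  obtain ⟨s, e, he, rfl⟩ := exists_eigenfunction_decomposition' hf
  refine (ContinuousMap.norm_le _ (norm_nonneg _)).mpr fun g => ?_
  have hval : heat t (∑ μ ∈ s, e μ) g = ∑ μ ∈ s, Real.exp (μ * t) * e μ g := by
    rw [map_sum]
    simp [fun μ => heat_eigenfunction t (he μ).1 (he μ).2]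
  have hb : ∀ g, |∑ μ ∈ s, e μ g| ≤ ‖∑ μ ∈ s, e μ‖ := fun g => by
    simpa using (∑ μ ∈ s, e μ).norm_coe_le_norm g
  rw [hval, Real.norm_eq_abs, abs_le']
  constructor
  · exact sum_exp_mul_le s (fun μ => e μ) he (fun g => (abs_le'.mp (hb g)).1) t.2 g
  · have := sum_exp_mul_le s (fun μ => (-1 : ℝ) • ⇑(e μ)) (M := ‖∑ μ ∈ s, e μ‖)
      (fun μ => ⟨poly.smul_mem (he μ).1 _, by rw [sublaplacian_smul, (he μ).2, smul_comm]⟩)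
      (fun g => by simpa using (abs_le'.mp (hb g)).2) t.2 g
    simpa using this

theorem heat_add (s t : ℝ≥0) : heat (s + t) = (heat s).comp (heat t) := by
  refine ContinuousLinearMap.ext fun f => ?_
  have hclosed : IsClosed {f : C(SU2, ℝ) | heat (s + t) f = heat s (heat t f)} :=
    isClosed_eq (by fun_prop) (by fun_prop)
  refine (hclosed.closure_subset_iff (s := {f : C(SU2, ℝ) | ⇑f ∈ poly})).mpr ?_ (dense_poly f)
  intro f hf
  obtain ⟨S, e, he, rfl⟩ := exists_eigenfunction_decomposition' hf
  simp only [Set.mem_ofPred_eq, map_sum, fun t μ => heat_eigenfunction t (he μ).1 (he μ).2, map_smul,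
    smul_smul, ← Real.exp_add]
  refine Finset.sum_congr rfl fun μ _ => ?_
  congr 2
  push_cast
  ring

theorem continuous_heat (f : C(SU2, ℝ)) : Continuous fun t => heat t f := by
  refine continuous_of_uniform_approx_of_continuous fun u hu => ?_
  obtain ⟨ε, hε, hεu⟩ := Metric.mem_uniformity_dist.mp hu
  obtain ⟨f', hf', hd⟩ := Metric.dense_iff.mp dense_poly f ε hε
  refine ⟨fun t => heat t f', ?_, fun t => hεu ?_⟩
  · obtain ⟨S, e, he, rfl⟩ := exists_eigenfunction_decomposition' hd
    simp only [map_sum, fun t μ => heat_eigenfunction t (he μ).1 (he μ).2]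
    fun_prop
  · rw [dist_eq_norm, ← map_sub]
    exact (norm_heat_le t _).trans_lt (by rw [← dist_eq_norm, dist_comm]; exact hf')

theorem hasDerivAt_heat {f : SU2 → ℝ} (hf : IsSmooth f) (g : SU2) {t : ℝ} (ht : 0 < t) :
    HasDerivAt (fun s : ℝ => heat s.toNNReal ⟨f, hf.continuous⟩ g)
      (heat t.toNNReal ⟨_, hf.sublaplacian.continuous⟩ g) t := by
  have h := hasDerivAt_integral_kernel ht (hf.comp_mul_left g)
  rw [sublaplacian_comp_mul_left] at h
  have e : ∀ {s : ℝ}, 0 < s → ∀ (u : C(SU2, ℝ)),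
      heat s.toNNReal u g = ∫ h, kernel s h * u (g * h) ∂haar := fun {s} hs u => by
    rw [heat_apply (Real.toNNReal_pos.mpr hs), Real.coe_toNNReal _ hs.le]
  rw [e ht]
  refine h.congr_of_eventuallyEq ?_
  filter_upwards [lt_mem_nhds ht] with s hs
  exact e hs _

theorem heat_generator (f : C(SU2, ℝ)) (hf : IsSmooth f) :
    TendstoUniformly (fun (t : ℝ≥0) (g : SU2) => (heat t f g - f g) / (t : ℝ))
      (sublaplacian f) (𝓝[>] 0) := by
  rw [Metric.tendstoUniformly_iff]
  intro ε hε
  set u : C(SU2, ℝ) := ⟨_, hf.sublaplacian.continuous⟩ with hu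
  have hcont := Metric.continuous_iff.mp (continuous_heat u) 0 ε hε
  obtain ⟨δ, hδ, hδε⟩ := hcont
  have hmem : ∀ᶠ t : ℝ≥0 in 𝓝[>] 0, 0 < t ∧ dist t 0 < δ :=
    (eventually_mem_nhdsWithin).and
      (Filter.Eventually.filter_mono nhdsWithin_le_nhds (Metric.ball_mem_nhds 0 hδ))
  filter_upwards [hmem] with t ⟨ht, htδ⟩ g
  have ht' : (0 : ℝ) < t := NNReal.coe_pos.mpr ht
  -- The difference quotient at `g` equals `heat c u g` for some c in (0, t). The time `c` depends
  -- on `g`, but `δ` does not, whence the uniformity.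
  obtain ⟨c, hc, hcs⟩ := exists_hasDerivAt_eq_slope (fun s : ℝ => heat s.toNNReal f g)
    (fun s : ℝ => heat s.toNNReal u g) ht'
    (((continuous_eval_const (F := C(SU2, ℝ)) g).comp ((continuous_heat f).comp
      continuous_real_toNNReal)).continuousOn) (fun s hs => hasDerivAt_heat hf g hs.1)
  simp only [Real.toNNReal_zero, heat_zero, Real.toNNReal_coe, sub_zero,
    ContinuousLinearMap.id_apply] at hcs
  rw [← hcs, dist_comm]
  have h1 : dist c.toNNReal 0 < δ := by
    refine lt_of_le_of_lt ?_ htδ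
    rw [NNReal.dist_eq, NNReal.dist_eq, Real.coe_toNNReal _ hc.1.le]
    simp only [NNReal.coe_zero, sub_zero]
    rw [abs_of_pos hc.1, abs_of_pos ht']
    exact hc.2.le
  have h2 := hδε _ h1
  rw [heat_zero] at h2
  exact (ContinuousMap.dist_apply_le_dist g).trans_lt h2

theorem isHeatSemigroup_heat : IsHeatSemigroup heat where
  zero := heat_zero
  add := heat_add
  strongly_continuous := continuous_heat
  generator := heat_generator

/-! ### Uniqueness of the semigroup and of its kernel -/

theorem IsHeatSemigroup.hasDerivWithinAt {P : ℝ≥0 → (C(SU2, ℝ) →L[ℝ] C(SU2, ℝ))}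
    (hP : IsHeatSemigroup P) {f f' : C(SU2, ℝ)} (hf : IsSmooth f) (hf' : sublaplacian f = f')
    {x : ℝ} (hx : 0 ≤ x) :
    HasDerivWithinAt (fun s : ℝ => P s.toNNReal f) (P x.toNNReal f') (Set.Ici x) x := by
  rw [← hasDerivWithinAt_Ioi_iff_Ici, hasDerivWithinAt_iff_tendsto_slope' (by simp)]
  have h1 : Filter.Tendsto (fun t : ℝ≥0 => (t : ℝ)⁻¹ • (P t f - f)) (𝓝[>] 0) (𝓝 f') := by
    rw [ContinuousMap.tendsto_iff_tendstoUniformly, ← hf']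
    have e : (fun (t : ℝ≥0) (g : SU2) => (P t f g - f g) / (t : ℝ)) =
        fun (t : ℝ≥0) (g : SU2) => ((t : ℝ)⁻¹ • (P t f - f)) g := by
      funext t g
      simp [div_eq_inv_mul]
    exact e ▸ hP.generator f hf
  have h2 : Filter.Tendsto (fun y : ℝ => (y - x).toNNReal) (𝓝[>] x) (𝓝[>] 0) := by
    refine tendsto_nhdsWithin_iff.mpr ⟨?_, ?_⟩
    · have : Continuous fun y : ℝ => (y - x).toNNReal := by fun_prop
      have := this.tendsto x
      simp only [sub_self, Real.toNNReal_zero] at this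
      exact this.mono_left nhdsWithin_le_nhds
    · filter_upwards [self_mem_nhdsWithin] with y hy
      exact Real.toNNReal_pos.mpr (sub_pos.mpr hy)
  refine (((P x.toNNReal).continuous.tendsto f').comp (h1.comp h2)).congr' ?_
  filter_upwards [self_mem_nhdsWithin] with y hy
  have hy : x < y := hy
  have hxy : y.toNNReal = x.toNNReal + (y - x).toNNReal := by
    rw [← Real.toNNReal_add hx (sub_pos.mpr hy).le]; congr 1; ring
  simp only [Function.comp, slope, hxy, hP.add, ContinuousLinearMap.comp_apply, vsub_eq_sub,
    map_smul, map_sub, Real.coe_toNNReal _ (sub_pos.mpr hy).le]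

/-- The curve s ↦ e^{-μs} P_s f is continuous with zero right derivative, hence constant; the
generator provides one-sided derivatives only. -/
theorem IsHeatSemigroup.apply_eigenfunction {P : ℝ≥0 → (C(SU2, ℝ) →L[ℝ] C(SU2, ℝ))}
    (hP : IsHeatSemigroup P) (t : ℝ≥0) {f : C(SU2, ℝ)} (hf : IsSmooth f) {μ : ℝ}
    (hμ : sublaplacian f = μ • ⇑f) : P t f = Real.exp (μ * t) • f := by
  have hcont : Continuous fun s : ℝ => Real.exp (-μ * s) • P s.toNNReal f :=
    (Real.continuous_exp.comp (continuous_const_mul (-μ))).smul ((hP.strongly_continuous f).comp continuous_real_toNNReal)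
  have key := constant_of_has_deriv_right_zero (a := 0) (b := t) hcont.continuousOn
    (fun x hx => by
      have h1 : HasDerivAt (fun s : ℝ => Real.exp (-μ * s)) (Real.exp (-μ * x) * -μ) x := by
        have := ((hasDerivAt_id x).const_mul (-μ)).exp
        simpa using this
      have h2 := h1.hasDerivWithinAt.fun_smul
        (hP.hasDerivWithinAt (f' := μ • f) hf (by rw [hμ]; rfl) hx.1)
      refine h2.congr_deriv ?_
      rw [map_smul]
      module) t ⟨t.2, le_rfl⟩
  simp only [Real.toNNReal_coe, Real.toNNReal_zero, mul_zero, Real.exp_zero, one_smul, hP.zero,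
    ContinuousLinearMap.id_apply] at key
  nth_rewrite 2 [← key]
  rw [smul_smul, ← Real.exp_add]
  simp

theorem IsHeatSemigroup.eq_heat {P : ℝ≥0 → (C(SU2, ℝ) →L[ℝ] C(SU2, ℝ))}
    (hP : IsHeatSemigroup P) : P = heat := by
  funext t
  refine ContinuousLinearMap.ext fun f => ?_
  have hclosed : IsClosed {f : C(SU2, ℝ) | P t f = heat t f} :=
    isClosed_eq (P t).continuous (heat t).continuous
  refine (hclosed.closure_subset_iff (s := {f : C(SU2, ℝ) | ⇑f ∈ poly})).mpr ?_ (dense_poly f)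
  intro f hf
  obtain ⟨S, e, he, rfl⟩ := exists_eigenfunction_decomposition' hf
  simp only [Set.mem_ofPred_eq, map_sum]
  refine Finset.sum_congr rfl fun μ _ => ?_
  rw [heat_eigenfunction t (he μ).1 (he μ).2,
    hP.apply_eigenfunction t (isSmooth_of_mem (he μ).1) (he μ).2]

theorem isKernelFromOne_kernel : IsKernelFromOne heat fun t => kernel t := fun t ht =>
  ⟨continuous_kernel (NNReal.coe_pos.mpr ht), fun f => by simp [heat_apply ht]⟩

/-- Testing both densities against their difference shows that its square has integral zero; a
continuous function that vanishes almost everywhere for Haar measure is zero. -/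
theorem IsKernelFromOne.eq_kernel {p : ℝ≥0 → SU2 → ℝ} (hp : IsKernelFromOne heat p) {t : ℝ≥0}
    (ht : 0 < t) : p t = kernel t := by
  obtain ⟨hpc, hpi⟩ := hp t ht
  obtain ⟨hkc, hki⟩ := isKernelFromOne_kernel t ht
  dsimp only at hkc hki
  set f : C(SU2, ℝ) := ⟨fun g => p t g - kernel t g, hpc.sub hkc⟩ with hf
  have hff : Continuous fun g => f g * f g := f.continuous.mul f.continuous
  have h1 := (hpi f).symm.trans (hki f)
  have h2 : ∫ g, f g * f g ∂haar = 0 := by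
    have I1 : MeasureTheory.Integrable (fun g => p t g * f g) haar :=
      integrable_of_continuous (by fun_prop)
    have I2 : MeasureTheory.Integrable (fun g => kernel t g * f g) haar :=
      integrable_of_continuous (by fun_prop)
    have : ∀ g, f g * f g = p t g * f g - kernel t g * f g := fun g => by simp [hf]; ring
    simp only [this]
    rw [MeasureTheory.integral_sub I1 I2, h1, sub_self]
  rw [MeasureTheory.integral_eq_zero_iff_of_nonneg (fun g => mul_self_nonneg _)
    (integrable_of_continuous hff), Continuous.ae_eq_iff_eq haar hff continuous_zero] at h2
  funext g
  have := congrFun h2 g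
  simp only [Pi.zero_apply, mul_self_eq_zero] at this
  exact sub_eq_zero.mp this

/-! ### Jacobi polynomials and the explicit formula -/

theorem iteratedDeriv_polynomial_eval (k : ℕ) (q : Polynomial ℝ) :
    iteratedDeriv k (fun y => q.eval y) = fun y => (Polynomial.derivative^[k] q).eval y := by
  induction k with
  | zero => simp
  | succ k ih =>
    rw [iteratedDeriv_succ, ih, Function.iterate_succ_apply']
    ext y
    exact Polynomial.deriv _

/-- Leibniz' rule for (-1)^k (y - 1)^k (y + 1)^{m+k}. The variable u stands for cos² r = |α|², and
`hu` allows cancelling (1 + x)^m = (2u)^m. -/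
theorem jacobiP_eq_sum (k m : ℕ) {u : ℝ} (hu : u ≠ 0) : jacobiP k m (2 * u - 1) =
    ∑ s ∈ Finset.range (k + 1), ((m + k).choose s : ℝ) * k.choose s * u ^ (k - s) * (u - 1) ^ s := by
  have h1 : (fun y : ℝ => (1 + y) ^ m * (1 - y ^ 2) ^ k) = fun y =>
      (Polynomial.C ((-1) ^ k) * ((Polynomial.X - Polynomial.C 1) ^ k *
        (Polynomial.X + Polynomial.C 1) ^ (m + k)) : Polynomial ℝ).eval y := by
    ext y
    simp only [Polynomial.eval_mul, Polynomial.eval_C, Polynomial.eval_pow, Polynomial.eval_sub,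
      Polynomial.eval_add, Polynomial.eval_X]
    rw [show 1 - y ^ 2 = (-1) * (y - 1) * (y + 1) by ring, mul_pow, mul_pow]
    ring
  unfold jacobiP
  rw [h1, iteratedDeriv_polynomial_eval, Polynomial.iterate_derivative_C_mul,
    Polynomial.iterate_derivative_mul]
  simp only [Polynomial.eval_mul, Polynomial.eval_C, Polynomial.eval_finsetSum, nsmul_eq_mul,
    Polynomial.iterate_derivative_X_sub_pow, Polynomial.iterate_derivative_X_add_pow,
    Polynomial.eval_natCast, Polynomial.eval_pow, Polynomial.eval_sub, Polynomial.eval_add,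
    Polynomial.eval_X]
  rw [← mul_assoc, Finset.mul_sum]
  refine Finset.sum_congr rfl fun s hs => ?_
  obtain ⟨j, rfl⟩ := Nat.exists_eq_add_of_le (Nat.lt_succ_iff.mp (Finset.mem_range.mp hs))
  have e1 : ((m + (s + j)).descFactorial s : ℝ) = s.factorial * (m + (s + j)).choose s := by
    exact_mod_cast Nat.descFactorial_eq_factorial_mul_choose _ _
  have e2 : (s.factorial : ℝ) * (s + j).descFactorial j = (s + j).factorial := by
    have := Nat.factorial_mul_descFactorial (by omega : j ≤ s + j)
    rw [show s + j - j = s by omega] at this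
    exact_mod_cast this
  rw [show s + j - s = j by omega, show s + j - j = s by omega,
    show m + (s + j) - s = m + j by omega, e1, ← e2,
    show 2 * u - 1 - 1 = 2 * (u - 1) by ring, show 2 * u - 1 + 1 = 2 * u by ring,
    show 1 + (2 * u - 1) = 2 * u by ring]
  have h3 : (s.factorial : ℝ) ≠ 0 := by exact_mod_cast s.factorial_ne_zero
  have h4 : ((s + j).descFactorial j : ℝ) ≠ 0 := by
    exact_mod_cast (Nat.descFactorial_pos.mpr (by omega)).ne'
  have h5 : ((-1 : ℝ) ^ (s + j)) * (-1) ^ (s + j) = 1 := by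
    rw [← mul_pow]; norm_num
  simp only [mul_pow, pow_add]
  simp only [pow_add] at h5
  field_simp
  linear_combination (u - 1) ^ s * ((s + j).choose s : ℝ) * ((m + (s + j)).choose s : ℝ) * h5

theorem phi_eq (n k : ℕ) (g : SU2) : phi n k g = α g ^ n *
    ((∑ s ∈ Finset.range (k + 1), ((n + k).choose s : ℝ) * k.choose s *
      (Complex.normSq (α g)) ^ (k - s) * (Complex.normSq (α g) - 1) ^ s : ℝ) : ℂ) := by
  rw [phi_apply]
  push_cast
  rw [Finset.mul_sum]
  refine Finset.sum_congr rfl fun s hs => ?_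
  obtain ⟨j, rfl⟩ := Nat.exists_eq_add_of_le (Nat.lt_succ_iff.mp (Finset.mem_range.mp hs))
  have h := α_mul_conj_add g
  rw [← Complex.mul_conj]
  have h2 : α g * conj (α g) - 1 = -(β g * conj (β g)) := by linear_combination h
  rw [h2, show n + (s + j) - s = n + j by omega, show s + j - s = j by omega, neg_pow]
  simp only [phiCoeff, mon]
  push_cast
  ring

theorem zonal_cyl (i : ℤ × ℕ) {r θ z : ℝ} (hr : Real.cos r ≠ 0) : zonal i (SU2.cyl r θ z) =
    Complex.exp (Complex.I * i.1 * z) *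
      ((Real.cos r ^ i.1.natAbs * jacobiP i.2 i.1.natAbs (Real.cos (2 * r)) : ℝ) : ℂ) := by
  have hnorm : Complex.normSq (α (SU2.cyl r θ z)) = Real.cos r ^ 2 := by
    rw [α_cyl, map_mul, Complex.normSq_ofReal, Complex.normSq_eq_norm_sq, mul_comm Complex.I,
      Complex.norm_exp_ofReal_mul_I]
    ring
  have hphi : ∀ n k, phi n k (SU2.cyl r θ z) = Complex.exp (Complex.I * n * z) *
      ((Real.cos r ^ n * jacobiP k n (Real.cos (2 * r)) : ℝ) : ℂ) := by
    intro n k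
    rw [phi_eq, hnorm, Real.cos_two_mul, jacobiP_eq_sum k n (pow_ne_zero 2 hr), α_cyl, mul_pow,
      ← Complex.exp_nat_mul]
    rw [show (n : ℂ) * (Complex.I * z) = Complex.I * n * z by ring]
    push_cast
    ring
  obtain ⟨n, k⟩ := i
  simp only [zonal]
  rw [hphi]
  split_ifs with hn
  · rw [show ((n.natAbs : ℕ) : ℂ) = (n : ℂ) by
      rw [← Int.cast_natCast, Int.natAbs_of_nonneg hn]]
  · rw [map_mul, Complex.conj_ofReal, ← Complex.exp_conj]
    simp only [map_mul, Complex.conj_I, Complex.conj_ofReal, map_natCast]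
    rw [show ((n.natAbs : ℕ) : ℂ) = -(n : ℂ) by
      rw [← Int.cast_natCast, Int.ofNat_natAbs_of_nonpos (not_le.mp hn).le, Int.cast_neg]]
    congr 2
    ring

/-- `kernel` sums real parts only; the complex series has the same sum because conjugation amounts
to the reindexing n ↦ -n. -/
theorem hasSum_kernel {t : ℝ} (ht : 0 < t) (g : SU2) :
    HasSum (fun i => ((weight i * Real.exp (-freq i * t) : ℝ) : ℂ) * zonal i g) (kernel t g : ℂ) := by
  have hs : Summable fun i => ((weight i * Real.exp (-freq i * t) : ℝ) : ℂ) * zonal i g := by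
    refine Summable.of_norm_bounded (summable_weight_mul_exp ht) fun i => ?_
    rw [norm_mul, Complex.norm_real, Real.norm_of_nonneg (by positivity)]
    exact mul_le_of_le_one_right (by positivity) (norm_zonal_le_one i g)
  have hS := hs.hasSum
  set S := ∑' i, ((weight i * Real.exp (-freq i * t) : ℝ) : ℂ) * zonal i g
  have hre : S.re = kernel t g := by
    refine ((Complex.hasSum_re hS).tsum_eq).symm.trans ?_
    simp only [Complex.re_ofReal_mul, ← reZonal_eq]
    rfl
  have hconj : conj S = S := by
    have h := ((Equiv.neg ℤ).prodCongr (Equiv.refl ℕ)).hasSum_iff.mpr (Complex.hasSum_conj'.mpr hS)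
    refine h.unique (hS.congr_fun fun i => ?_)
    simp only [Function.comp, Equiv.prodCongr_apply, Prod.map, Equiv.neg_apply, Equiv.refl_apply,
      map_mul, Complex.conj_ofReal, conj_zonal, weight, freq, Int.natAbs_neg, neg_neg]
  rw [← hre, Complex.conj_eq_iff_re.mp hconj]
  exact hS

end SU2

theorem proposition3p1 :
    (∃! P : ℝ≥0 → (C(SU2, ℝ) →L[ℝ] C(SU2, ℝ)), SU2.IsHeatSemigroup P) ∧
    ∀ P : ℝ≥0 → (C(SU2, ℝ) →L[ℝ] C(SU2, ℝ)), SU2.IsHeatSemigroup P →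
      (∃ p : ℝ≥0 → SU2 → ℝ, SU2.IsKernelFromOne P p) ∧
      ∀ p : ℝ≥0 → SU2 → ℝ, SU2.IsKernelFromOne P p →
        ∀ t : ℝ≥0, 0 < t →
        ∀ r ∈ Set.Ico 0 (Real.pi / 2), ∀ θ ∈ Set.Icc 0 (2 * Real.pi),
        ∀ z ∈ Set.Icc (-Real.pi) Real.pi,
          HasSum (fun nk : ℤ × ℕ =>
              ((2 * (nk.2 : ℂ) + (nk.1.natAbs : ℂ) + 1) *
                (Real.exp (-(4 * (nk.2 : ℝ) * ((nk.2 : ℝ) + (nk.1.natAbs : ℝ) + 1)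
                  + 2 * (nk.1.natAbs : ℝ)) * (t : ℝ)) : ℂ) *
                Complex.exp (Complex.I * (nk.1 : ℂ) * (z : ℂ)) *
                ((Real.cos r ^ nk.1.natAbs *
                  jacobiP nk.2 nk.1.natAbs (Real.cos (2 * r)) : ℝ) : ℂ)))
            ((p t (SU2.cyl r θ z) : ℝ) : ℂ) := by
  refine ⟨⟨SU2.heat, SU2.isHeatSemigroup_heat, fun P hP => hP.eq_heat⟩, fun P hP => ?_⟩
  obtain rfl := hP.eq_heat
  refine ⟨⟨_, SU2.isKernelFromOne_kernel⟩, fun p hp t ht r hr θ _ z _ => ?_⟩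
  rw [hp.eq_kernel ht]
  have hcos : Real.cos r ≠ 0 := (Real.cos_pos_of_mem_Ioo
    ⟨by linarith [hr.1, Real.pi_pos], hr.2⟩).ne'
  refine (SU2.hasSum_kernel (NNReal.coe_pos.mpr ht) (SU2.cyl r θ z)).congr_fun fun i => ?_
  rw [SU2.zonal_cyl i hcos, SU2.weight, SU2.freq, SU2.eigenvalue]
  push_cast
  ring
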